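/- Let $X$ be a complex Banach space and let $-A$ be the generator of a sectorially bounded holomorphic $C_0$-semigroup $(e^{-tA})_{t\ge 0}$ on $X$; that is, for some $\theta\in(0,\pi/2]$ the semigroup extends holomorphically to the sector $\Sigma_\theta=\{z\ne 0:|\arg z|<\theta\}$ and is bounded and strongly continuous on $\overline{\Sigma}_\xi$ for every $0<\xi<\theta$. Put $$M_k:=\sup_{t>0}\|t^kA^ke^{-tA}\|\quad(k=0,1,2),\qquad K:=3M_0+3M_1+\tfrac12M_2 .$$ For every $t>0$ let $g_t:(0,\infty)\to[0,\infty)$ be a completely monotone function (i.e. $g_t\in C^\infty(0,\infty)$ and $(-1)^kg_t^{(k)}\ge 0$ for all $k\ge 0$) with $$g_t(0)=1,\qquad g_t'(0)=-1,\qquad g_t''(0)<\infty ,$$ where $g_t^{(k)}(0):=\lim_{z\to0+}g_t^{(k)}(z)$. For a bounded completely monotone $g$, i.e. $g(z)=\int_{[0,\infty)}e^{-zs}\,\nu(ds)$ with a bounded positive Borel measure $\nu$, and for a generator $-B$ of a bounded $C_0$-semigroup, $g(B):=\int_{[0,\infty)}e^{-sB}\,\nu(ds)$ (strong Bochner integral);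 $g_t^n(tA/n)$ denotes the function $g_t^n$ of the operator $B=\frac tnA$. Then $e^{-tA}X\subset\operatorname{dom}(A^k)$ for $t>0$ and $M_k<\infty$ for $k=0,1,2$, and for all integers $n\ge1$ and all $t>0$: 1. $\displaystyle\|g_t^n(tA/n)x-e^{-tA}x\|\le\Bigl(2M_0+\tfrac32M_1\Bigr)\frac{g_t''(0)-1}{n}\,t\,\|Ax\|$ for all $x\in\operatorname{dom}(A)$; 2. $\displaystyle\|g_t^n(tA/n)-e^{-tA}\|\le K\,\frac{g_t''(0)-1}{n}$; 3. $\displaystyle\|g_t^n(tA/n)x-e^{-tA}x\|\le\min\{4,\,3M_0\}\,K\,\frac{g_t''(0)-1}{n}\,t^\alpha\,\|A^\alpha x\|$ for all $\alpha\in(0,1)$ and all $x\in\operatorname{dom}(A^\alpha)$. -/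

import Mathlib

open Filter Topology MeasureTheory Set

noncomputable section

/-- `T` (restricted to `[0, ∞)`) is a `C₀`-semigroup of bounded linear operators on `X`;
the values `T s` with `s < 0` are irrelevant. -/
structure IsC0Semigroup {X : Type*} [NormedAddCommGroup X] [NormedSpace ℂ X]
    (T : ℝ → X →L[ℂ] X) : Prop where
  map_zero : T 0 = ContinuousLinearMap.id ℂ X
  map_add : ∀ s t : ℝ, 0 ≤ s → 0 ≤ t → T (s + t) = (T s).comp (T t)
  tendsto_zero : ∀ x : X, Tendsto (fun h : ℝ => T h x) (𝓝[>] 0) (𝓝 x)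

/-- `T` is sectorially bounded holomorphic: for some `θ ∈ (0, π/2]` it extends to a function `S`
that is holomorphic on the open sector `{z ≠ 0, |arg z| < θ}`, and bounded and strongly continuous
on each smaller closed sector `{|arg z| ≤ ξ}`, `0 < ξ < θ`
(which contains `0`, because `Complex.arg 0 = 0`). -/
def IsSectoriallyBoundedHolomorphic {X : Type*} [NormedAddCommGroup X] [NormedSpace ℂ X]
    (T : ℝ → X →L[ℂ] X) : Prop :=
  ∃ θ ∈ Ioc 0 (Real.pi / 2), ∃ S : ℂ → X →L[ℂ] X,
    (∀ t : ℝ, 0 ≤ t → S (t : ℂ) = T t) ∧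
    DifferentiableOn ℂ S {z : ℂ | z ≠ 0 ∧ |z.arg| < θ} ∧
    ∀ ξ ∈ Ioo 0 θ,
      (∃ C : ℝ, ∀ z : ℂ, |z.arg| ≤ ξ → ‖S z‖ ≤ C) ∧
      ∀ x : X, ContinuousOn (fun z : ℂ => S z x) {z : ℂ | |z.arg| ≤ ξ}

/-- The graph of `A`, where `-A` is the generator of `T`: the relation
`x ∈ dom A` and `A x = y`, that is, `y = lim_{h → 0+} (x - T h x) / h`. -/
def OpGraph {X : Type*} [NormedAddCommGroup X] [NormedSpace ℂ X]
    (T : ℝ → X →L[ℂ] X) (x y : X) : Prop :=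
  Tendsto (fun h : ℝ => h⁻¹ • (x - T h x)) (𝓝[>] 0) (𝓝 y)

/-- The graph of `A ^ k`, `k = 0, 1, 2, …`: the relation `x ∈ dom (A ^ k)` and `A ^ k x = y`. -/
def OpPowGraph {X : Type*} [NormedAddCommGroup X] [NormedSpace ℂ X]
    (T : ℝ → X →L[ℂ] X) : ℕ → X → X → Prop
  | 0 => fun x y => x = y
  | k + 1 => fun x y => ∃ z : X, OpGraph T x z ∧ OpPowGraph T k z y

/-- `B = A ^ k e^{-tA}`: the range of `e^{-tA} = T t` lies in `dom (A ^ k)` and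
`B x = A ^ k (T t x)` for all `x`. -/
def IsPowSemigroup {X : Type*} [NormedAddCommGroup X] [NormedSpace ℂ X]
    (T : ℝ → X →L[ℂ] X) (k : ℕ) (t : ℝ) (B : X →L[ℂ] X) : Prop :=
  ∀ x : X, OpPowGraph T k (T t x) (B x)

/-- The set of all numbers `‖t ^ k A ^ k e^{-tA}‖`, `t > 0`. -/
def powNorms {X : Type*} [NormedAddCommGroup X] [NormedSpace ℂ X]
    (T : ℝ → X →L[ℂ] X) (k : ℕ) : Set ℝ :=
  {r : ℝ | ∃ t : ℝ, 0 < t ∧ ∃ B : X →L[ℂ] X, IsPowSemigroup T k t B ∧ r = ‖(t ^ k : ℝ) • B‖}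

/-- `M_k = sup_{t > 0} ‖t ^ k A ^ k e^{-tA}‖`. -/
def supM {X : Type*} [NormedAddCommGroup X] [NormedSpace ℂ X]
    (T : ℝ → X →L[ℂ] X) (k : ℕ) : ℝ :=
  sSup (powNorms T k)

/-- The Balakrishnan operator on `dom A`, for `0 < α < 1`:
`x ∈ dom A` and `y = (sin (π α) / π) ∫₀^∞ r ^ (α - 1) (r + A)⁻¹ A x dr`.
Here `u r = (r + A)⁻¹ A x`, that is, `u r ∈ dom A` and `A (u r) = A x - r u r`. -/
def BalakrishnanGraph {X : Type*} [NormedAddCommGroup X] [NormedSpace ℂ X]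
    (T : ℝ → X →L[ℂ] X) (α : ℝ) (x y : X) : Prop :=
  ∃ (v : X) (u : ℝ → X), OpGraph T x v ∧
    (∀ r : ℝ, 0 < r → OpGraph T (u r) (v - r • u r)) ∧
    IntegrableOn (fun r : ℝ => r ^ (α - 1) • u r) (Ioi 0) ∧
    y = (Real.sin (Real.pi * α) / Real.pi) • ∫ r in Ioi (0 : ℝ), r ^ (α - 1) • u r

/-- The graph of the fractional power `A ^ α`, `0 < α < 1` (`x ∈ dom (A ^ α)` and `A ^ α x = y`):
`A ^ α` is the closure of the Balakrishnan operator on the dense subspace `dom A`. -/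
def FracPowGraph {X : Type*} [NormedAddCommGroup X] [NormedSpace ℂ X]
    (T : ℝ → X →L[ℂ] X) (α : ℝ) (x y : X) : Prop :=
  (x, y) ∈ closure {p : X × X | BalakrishnanGraph T α p.1 p.2}

/-- Completely monotone functions on `(0, ∞)`. The values of `g` on `(-∞, 0]` are irrelevant. -/
def IsCompletelyMonotone (g : ℝ → ℝ) : Prop :=
  ContDiffOn ℝ (⊤ : ℕ∞) g (Ioi 0) ∧
    ∀ k : ℕ, ∀ z : ℝ, 0 < z → 0 ≤ (-1) ^ k * iteratedDeriv k g z

/-- `g` is completely monotone with `g(0) = 1`, `g'(0) = -1` and `g''(0) = c < ∞`, where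
`g^{(k)}(0)` is the limit of `g^{(k)}(z)` as `z → 0+`. -/
def IsNormalizedCM (g : ℝ → ℝ) (c : ℝ) : Prop :=
  IsCompletelyMonotone g ∧
    Tendsto g (𝓝[>] 0) (𝓝 1) ∧
    Tendsto (deriv g) (𝓝[>] 0) (𝓝 (-1)) ∧
    Tendsto (iteratedDeriv 2 g) (𝓝[>] 0) (𝓝 c)

/-- `g ∼ ν`: `ν` is a bounded positive Borel measure on `[0, ∞)` with Laplace transform `g`. -/
def IsLaplaceTransformOf (g : ℝ → ℝ) (ν : Measure ℝ) : Prop :=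
  IsFiniteMeasure ν ∧ ν (Iio 0) = 0 ∧ ∀ z : ℝ, 0 < z → g z = ∫ s, Real.exp (-z * s) ∂ν

/-- `B = ∫ T s ν(ds)` as a strong Bochner integral, for some `ν` with `g ∼ ν`. -/
def IsHillePhillips {X : Type*} [NormedAddCommGroup X] [NormedSpace ℂ X]
    (T : ℝ → X →L[ℂ] X) (g : ℝ → ℝ) (B : X →L[ℂ] X) : Prop :=
  ∃ ν : Measure ℝ, IsLaplaceTransformOf g ν ∧
    ∀ x : X, Integrable (fun s : ℝ => T s x) ν ∧ B x = ∫ s, T s x ∂ν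

open Classical in
/-- The Hille-Phillips calculus: `g(A) = ∫ e^{-sA} ν(ds)` if `g ∼ ν` and `T s = e^{-sA}`. As `g`
determines `ν`, the value does not depend on the choice; it is `0` if `g` has no such `ν`. -/
def hillePhillips {X : Type*} [NormedAddCommGroup X] [NormedSpace ℂ X]
    (T : ℝ → X →L[ℂ] X) (g : ℝ → ℝ) : X →L[ℂ] X :=
  if h : ∃ B : X →L[ℂ] X, IsHillePhillips T g B then h.choose else 0

/-- `g ^ n (tA / n)`: the function `g ^ n` of the operator `(t / n) A`, where `T s = e^{-sA}`,
so that `e^{-s (t / n) A} = T ((t / n) s)`. -/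
def approximant {X : Type*} [NormedAddCommGroup X] [NormedSpace ℂ X]
    (T : ℝ → X →L[ℂ] X) (g : ℝ → ℝ) (n : ℕ) (t : ℝ) : X →L[ℂ] X :=
  hillePhillips (fun s : ℝ => T (t / n * s)) (fun z : ℝ => g z ^ n)

end

/-! By Bernstein's theorem `g ^ n` is the Laplace transform of a probability measure `ν` on `[0,
∞)`. Differentiating at `0` shows that `s / n` has mean `1` and variance `(c - 1) / n` under `ν`.
The approximation error applied to `x` is therefore the integral of the Taylor remainder `T (t s /
n) x - T t x + (s / n - 1) t A T t x`, since the linear term has mean zero. If this remainder is at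
most `Q (s / n - 1) ^ 2`, the error is at most `Q (c - 1) / n`
(`IsNormalizedCM.norm_semigroup_error_le`).

Everything then rests on finding `Q`. The second derivative `A² T u` is only `O(u⁻²)`, so Taylor's
formula alone gives a remainder with a logarithm at `0`. Balancing it against the first-order bound,
and using the boundedness of `T` very close to `0`, gives `Q = K ‖x‖` (`norm_taylor_le`). For `x` in
`dom A` the second derivative is `O(u⁻¹)`, and `Q = M₁ t ‖A x‖` suffices.

For fractional powers, let `D` be the error operator. It commutes with the semigroup, and the same
argument started at time `r` gives `‖T r D‖ ≤ κ min(1, t² / r²)` with `κ = K (c - 1) / n`. The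
formula `Γ(α) D x = ∫ r ^ (α - 1) T r D A^α x dr` then bounds `D x` by `κ t ^ α ‖A^α x‖` times `(1 /
α + 1 / (2 - α)) / Γ(α) ≤ 2` (`BalakrishnanGraph.norm_apply_le`). The factor `2` is below both `4`
and `3 M₀`, as `M₀ ≥ 1` unless `X` is trivial. -/

/-! ### Bernstein's theorem. -/

namespace IsCompletelyMonotone

open scoped Nat

variable {g : ℝ → ℝ}

lemma contDiffAt (hg : IsCompletelyMonotone g) {z : ℝ} (hz : 0 < z) :
    ContDiffAt ℝ (⊤ : ℕ∞) g z :=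
  hg.1.contDiffAt (Ioi_mem_nhds hz)

/-- The remainder in Taylor's formula of order `n` at `m`, in integral form. -/
lemma taylor_remainder (hg : IsCompletelyMonotone g) {z m : ℝ} (hz : 0 < z) (hzm : z < m) (n : ℕ) :
    g z - ∑ k ∈ Finset.range (n + 1), (-1) ^ k * iteratedDeriv k g m * (m - z) ^ k / k ! =
      ∫ t in z..m, (t - z) ^ n / n ! * ((-1) ^ (n + 1) * iteratedDeriv (n + 1) g t) := by
  have hpos : ∀ t ∈ uIcc m z, 0 < t := fun t ht => by
    rw [uIcc_of_ge hzm.le] at ht; exact hz.trans_le ht.1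
  have hcd : ContDiffOn ℝ ((n + 1 : ℕ) : WithTop ℕ∞) g (uIcc m z) := fun t ht =>
    ((hg.contDiffAt (hpos t ht)).of_le (by exact_mod_cast le_top)).contDiffWithinAt
  have key := taylor_integral_remainder (n := n) hcd
  have hiter : ∀ k : ℕ, ∀ t ∈ uIcc m z,
      iteratedDerivWithin k g (uIcc m z) t = iteratedDeriv k g t := fun k t ht =>
    iteratedDerivWithin_eq_iteratedDeriv (uniqueDiffOn_uIcc hzm.ne')
      ((hg.contDiffAt (hpos t ht)).of_le (by exact_mod_cast le_top)) ht
  rw [taylor_within_apply] at key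
  have hsum : ∑ k ∈ Finset.range (n + 1), ((k ! : ℝ)⁻¹ * (z - m) ^ k) •
        iteratedDerivWithin k g (uIcc m z) m =
      ∑ k ∈ Finset.range (n + 1), (-1) ^ k * iteratedDeriv k g m * (m - z) ^ k / k ! := by
    refine Finset.sum_congr rfl fun k _ => ?_
    rw [hiter k m left_mem_uIcc, smul_eq_mul, show z - m = (-1) * (m - z) by ring, mul_pow]
    ring
  rw [← hsum, key, intervalIntegral.integral_symm, ← intervalIntegral.integral_neg]
  refine intervalIntegral.integral_congr fun t ht => ?_
  rw [uIcc_comm] at ht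
  simp only [smul_eq_mul]
  rw [hiter (n + 1) t ht, show z - t = (-1) * (t - z) by ring, mul_pow, pow_succ]
  ring

lemma continuousOn_iteratedDeriv (hg : IsCompletelyMonotone g) (k : ℕ) :
    ContinuousOn (iteratedDeriv k g) (Ioi 0) := by
  have h := hg.1.continuousOn_iteratedDerivWithin (m := k) (by exact_mod_cast le_top)
    (uniqueDiffOn_Ioi (0 : ℝ))
  refine h.congr fun t ht => ?_
  exact (iteratedDerivWithin_eq_iteratedDeriv (uniqueDiffOn_Ioi (0 : ℝ))
    ((hg.contDiffAt ht).of_le (by exact_mod_cast le_top)) ht).symm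

/-- A completely monotone function is the sum of its Taylor series at `m` on `(0, m]`. -/
lemma hasSum_taylor (hg : IsCompletelyMonotone g) {z m : ℝ} (hz : 0 < z) (hzm : z < m) :
    HasSum (fun k : ℕ => (-1) ^ k * iteratedDeriv k g m * (m - z) ^ k / k !) (g z) := by
  have hm : 0 < m := hz.trans hzm
  have hnn : ∀ w : ℝ, w < m → ∀ k : ℕ,
      0 ≤ (-1) ^ k * iteratedDeriv k g m * (m - w) ^ k / k ! := fun w hw k =>
    div_nonneg (mul_nonneg (hg.2 k m hm) (pow_nonneg (sub_nonneg.2 hw.le) k)) (by positivity)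
  rw [hasSum_iff_tendsto_nat_of_nonneg (hnn z hzm)]
  -- Any point of `(0, z)` would do. On `[z, m]` one has `t - z ≤ q (t - w)` with `q < 1`, so the
  -- remainder at `z` is at most `q ^ n` times the remainder at `w`, which is at most `g w` because
  -- the Taylor terms are nonnegative.
  set w := z / 2 with hw
  have hw0 : 0 < w := by positivity
  have hwz : w < z := by simp only [hw]; linarith
  have hwm : w < m := hwz.trans hzm
  set q := (m - z) / (m - w) with hq
  have hmw : 0 < m - w := sub_pos.2 hwm
  have hq0 : 0 ≤ q := div_nonneg (sub_nonneg.2 hzm.le) hmw.le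
  have hq1 : q < 1 := by rw [hq, div_lt_one hmw]; linarith
  have hint : ∀ (v : ℝ) (n : ℕ) (a : ℝ), 0 < a → a ≤ m → IntervalIntegrable
      (fun t => (t - v) ^ n / n ! * ((-1) ^ (n + 1) * iteratedDeriv (n + 1) g t)) volume a m := by
    intro v n a ha ham
    refine ContinuousOn.intervalIntegrable ?_
    have h1 : ContinuousOn (iteratedDeriv (n + 1) g) (uIcc a m) :=
      (hg.continuousOn_iteratedDeriv (n + 1)).mono fun t ht => by
        rw [uIcc_of_le ham] at ht; exact ha.trans_le ht.1
    fun_prop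
  have hbound : ∀ n : ℕ,
      ‖g z - ∑ k ∈ Finset.range (n + 1), (-1) ^ k * iteratedDeriv k g m * (m - z) ^ k / (k ! : ℝ)‖
        ≤ q ^ n * g w := by
    intro n
    have hpos : ∀ t ∈ Icc w m, 0 ≤ (-1) ^ (n + 1) * iteratedDeriv (n + 1) g t := fun t ht =>
      hg.2 (n + 1) t (hw0.trans_le ht.1)
    have hwle : ∫ t in w..m, (t - w) ^ n / n ! * ((-1) ^ (n + 1) * iteratedDeriv (n + 1) g t)
        ≤ g w := by
      rw [← hg.taylor_remainder hw0 hwm n]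
      linarith [Finset.sum_nonneg fun k (_ : k ∈ Finset.range (n + 1)) => hnn w hwm k]
    rw [hg.taylor_remainder hz hzm n, Real.norm_of_nonneg]
    · calc ∫ t in z..m, (t - z) ^ n / n ! * ((-1) ^ (n + 1) * iteratedDeriv (n + 1) g t)
          ≤ ∫ t in z..m, q ^ n *
            ((t - w) ^ n / n ! * ((-1) ^ (n + 1) * iteratedDeriv (n + 1) g t)) := by
            refine intervalIntegral.integral_mono_on hzm.le (hint z n z hz hzm.le)
              ((hint w n z hz hzm.le).const_mul _) fun t ht => ?_
            rw [← mul_assoc (q ^ n)]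
            refine mul_le_mul_of_nonneg_right ?_ (hpos t ⟨hwz.le.trans ht.1, ht.2⟩)
            rw [← mul_div_assoc, ← mul_pow]
            gcongr
            · linarith [ht.1]
            · rw [hq, div_mul_eq_mul_div, le_div_iff₀ hmw]
              nlinarith [ht.1, ht.2]
        _ = q ^ n * ∫ t in z..m,
              (t - w) ^ n / n ! * ((-1) ^ (n + 1) * iteratedDeriv (n + 1) g t) := by
            rw [intervalIntegral.integral_const_mul]
        _ ≤ q ^ n * ∫ t in w..m,
              (t - w) ^ n / n ! * ((-1) ^ (n + 1) * iteratedDeriv (n + 1) g t) := by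
            refine mul_le_mul_of_nonneg_left ?_ (pow_nonneg hq0 n)
            refine intervalIntegral.integral_mono_interval hwz.le hzm.le le_rfl ?_
              (hint w n w hw0 hwm.le)
            refine (ae_restrict_mem measurableSet_Ioc).mono fun t ht => ?_
            exact mul_nonneg (div_nonneg (pow_nonneg (by linarith [ht.1]) n) (by positivity))
              (hpos t ⟨ht.1.le, ht.2⟩)
        _ ≤ q ^ n * g w := mul_le_mul_of_nonneg_left hwle (pow_nonneg hq0 n)
    · refine intervalIntegral.integral_nonneg hzm.le fun t ht => ?_
      exact mul_nonneg (div_nonneg (pow_nonneg (by linarith [ht.1]) n) (by positivity))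
        (hpos t ⟨hwz.le.trans ht.1, ht.2⟩)
  have hlim : Tendsto (fun n : ℕ => q ^ n * g w) atTop (𝓝 0) := by
    simpa using (tendsto_pow_atTop_nhds_zero_of_lt_one hq0 hq1).mul_const (g w)
  have h0 := squeeze_zero_norm hbound hlim
  rw [← tendsto_add_atTop_iff_nat 1]
  simpa using h0.const_sub (g z)

lemma antitoneOn (hg : IsCompletelyMonotone g) : AntitoneOn g (Ioi 0) := by
  refine antitoneOn_of_deriv_nonpos (convex_Ioi 0) hg.1.continuousOn ?_ ?_
  · rw [interior_Ioi]
    exact fun t ht => ((hg.contDiffAt ht).differentiableAt (by simp)).differentiableWithinAt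
  · rw [interior_Ioi]
    intro t ht
    have := hg.2 1 t ht
    rw [iteratedDeriv_one] at this
    linarith

lemma le_one (hg : IsCompletelyMonotone g) (h1 : Tendsto g (𝓝[>] 0) (𝓝 1)) {z : ℝ} (hz : 0 < z) :
    g z ≤ 1 := by
  refine ge_of_tendsto h1 ?_
  filter_upwards [Ioo_mem_nhdsGT hz] with w hw
  exact hg.antitoneOn hw.1 hz hw.2.le

/-- Each term increases as `z` decreases to `0`. Finite sums pass to the limit and stay below `1`;
conversely the whole series at `0` dominates every `g z`, hence `1`. -/
lemma hasSum_taylor_zero (hg : IsCompletelyMonotone g) (h1 : Tendsto g (𝓝[>] 0) (𝓝 1))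
    {m : ℝ} (hm : 0 < m) :
    HasSum (fun k : ℕ => (-1) ^ k * iteratedDeriv k g m * m ^ k / k !) 1 := by
  have hnn : ∀ w : ℝ, w ≤ m → ∀ k : ℕ,
      0 ≤ (-1) ^ k * iteratedDeriv k g m * (m - w) ^ k / k ! := fun w hw k =>
    div_nonneg (mul_nonneg (hg.2 k m hm) (pow_nonneg (sub_nonneg.2 hw) k)) (by positivity)
  have hnn0 : ∀ k : ℕ, 0 ≤ (-1) ^ k * iteratedDeriv k g m * m ^ k / k ! := fun k => by
    simpa using hnn 0 hm.le k
  have hpart : ∀ N : ℕ,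
      ∑ k ∈ Finset.range N, (-1) ^ k * iteratedDeriv k g m * m ^ k / k ! ≤ 1 := by
    intro N
    have hc : Tendsto (fun z : ℝ => ∑ k ∈ Finset.range N,
        (-1) ^ k * iteratedDeriv k g m * (m - z) ^ k / k !) (𝓝[>] 0)
        (𝓝 (∑ k ∈ Finset.range N, (-1) ^ k * iteratedDeriv k g m * (m - 0) ^ k / k !)) :=
      Continuous.continuousWithinAt (by fun_prop)
    rw [sub_zero] at hc
    refine le_of_tendsto hc ?_
    filter_upwards [Ioo_mem_nhdsGT hm] with z hz
    exact (sum_le_hasSum _ (fun k _ => hnn z hz.2.le k) (hg.hasSum_taylor hz.1 hz.2)).trans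
      (hg.le_one h1 hz.1)
  have hs := summable_of_sum_range_le hnn0 hpart
  have hle : ∑' k : ℕ, (-1) ^ k * iteratedDeriv k g m * m ^ k / k ! ≤ 1 :=
    hs.tsum_le_of_sum_range_le hpart
  have hge : 1 ≤ ∑' k : ℕ, (-1) ^ k * iteratedDeriv k g m * m ^ k / k ! := by
    refine le_of_tendsto h1 ?_
    filter_upwards [Ioo_mem_nhdsGT hm] with z hz
    refine hasSum_le (fun k => ?_) (hg.hasSum_taylor hz.1 hz.2) hs.hasSum
    have := hg.2 k m hm
    have h3 : (m - z) ^ k ≤ m ^ k :=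
      pow_le_pow_left₀ (sub_nonneg.2 hz.2.le) (by linarith [hz.1]) k
    gcongr
  simpa only [le_antisymm hle hge] using hs.hasSum

/-- The discrete probability measures whose Laplace transforms approximate `g`. -/
lemma exists_discrete_measure (hg : IsCompletelyMonotone g) (h1 : Tendsto g (𝓝[>] 0) (𝓝 1))
    {m : ℝ} (hm : 0 < m) :
    ∃ μ : ProbabilityMeasure ℝ, (μ : Measure ℝ) (Iio 0) = 0 ∧
      ∀ l : ℝ, 0 < l → ∫ s, Real.exp (-l * s) ∂(μ : Measure ℝ) =
        g (m * (1 - Real.exp (-l / m))) := by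
  -- The mass `p k` is placed at `k / m`: expanding `g` about `m` at the point `m (1 - exp (-l /
  -- m))` produces exactly `∑ p k exp (-l k / m)`.
  set p : ℕ → ℝ := fun k => (-1) ^ k * iteratedDeriv k g m * m ^ k / k ! with hp
  have hp0 : ∀ k, 0 ≤ p k := fun k =>
    div_nonneg (mul_nonneg (hg.2 k m hm) (pow_nonneg hm.le k)) (by positivity)
  have hsum : HasSum p 1 := hg.hasSum_taylor_zero h1 hm
  let P : PMF ℕ := ⟨fun k => ENNReal.ofReal (p k), by
    rw [ENNReal.summable.hasSum_iff, ← ENNReal.ofReal_tsum_of_nonneg hp0 hsum.summable,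
      hsum.tsum_eq, ENNReal.ofReal_one]⟩
  have hmeas : Measurable (fun k : ℕ => (k : ℝ) / m) := measurable_from_nat
  have : IsProbabilityMeasure (P.toMeasure.map (fun k : ℕ => (k : ℝ) / m)) :=
    Measure.isProbabilityMeasure_map hmeas.aemeasurable
  refine ⟨⟨P.toMeasure.map (fun k : ℕ => (k : ℝ) / m), this⟩, ?_, fun l hl => ?_⟩
  · rw [ProbabilityMeasure.coe_mk, Measure.map_apply hmeas measurableSet_Iio]
    convert measure_empty (μ := P.toMeasure)
    ext k
    simp only [mem_preimage, mem_Iio, mem_empty_iff_false, iff_false, not_lt]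
    positivity
  · rw [ProbabilityMeasure.coe_mk, integral_map hmeas.aemeasurable (by fun_prop),
      PMF.integral_eq_tsum]
    · have he : Real.exp (-l / m) < 1 := by
        rw [Real.exp_lt_one_iff]; exact div_neg_of_neg_of_pos (by linarith) hm
      have hz : 0 < m * (1 - Real.exp (-l / m)) := mul_pos hm (by linarith)
      have hzm : m * (1 - Real.exp (-l / m)) < m := by nlinarith [Real.exp_pos (-l / m)]
      rw [← (hg.hasSum_taylor hz hzm).tsum_eq]
      refine tsum_congr fun k => ?_
      change (ENNReal.ofReal (p k)).toReal • _ = _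
      rw [ENNReal.toReal_ofReal (hp0 k), smul_eq_mul,
        show m - m * (1 - Real.exp (-l / m)) = m * Real.exp (-l / m) by ring, mul_pow,
        ← Real.exp_nat_mul, show -l * (k / m) = k * (-l / m) by ring]
      simp only [hp]
      ring
    · refine Integrable.of_bound (C := 1) (by fun_prop) (ae_of_all _ fun k => ?_)
      rw [Real.norm_of_nonneg (Real.exp_pos _).le, Real.exp_le_one_iff]
      have : 0 ≤ (k : ℝ) / m := by positivity
      nlinarith

/-- **Bernstein's theorem** for completely monotone functions with limit `1` at `0`. -/
theorem exists_isLaplaceTransformOf (hg : IsCompletelyMonotone g)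
    (h1 : Tendsto g (𝓝[>] 0) (𝓝 1)) : ∃ ν : Measure ℝ, IsLaplaceTransformOf g ν := by
  choose μ hμ0 hμ using fun m : ℕ =>
    hg.exists_discrete_measure h1 (m := (m : ℝ) + 1) (by positivity)
  have hsub : ∀ l : ℝ, ∀ m : ℕ, ((m : ℝ) + 1) * (1 - Real.exp (-l / (m + 1))) ≤ l := by
    intro l m
    have hm : (0 : ℝ) < m + 1 := by positivity
    have h := Real.add_one_le_exp (-l / (m + 1))
    have h2 : 1 - Real.exp (-l / (m + 1)) ≤ l / (m + 1) := by
      rw [neg_div] at h ⊢; linarith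
    calc ((m : ℝ) + 1) * (1 - Real.exp (-l / (m + 1))) ≤ (m + 1) * (l / (m + 1)) := by gcongr
      _ = l := by field_simp
  have hpos : ∀ l : ℝ, 0 < l → ∀ m : ℕ, 0 < ((m : ℝ) + 1) * (1 - Real.exp (-l / (m + 1))) := by
    intro l hl m
    have hm : (0 : ℝ) < m + 1 := by positivity
    refine mul_pos hm (sub_pos.2 ?_)
    rw [Real.exp_lt_one_iff]
    exact div_neg_of_neg_of_pos (by linarith) hm
  have hlim : ∀ l : ℝ, 0 < l → Tendsto (fun m : ℕ => ∫ s, Real.exp (-l * s) ∂(μ m : Measure ℝ))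
      atTop (𝓝 (g l)) := by
    intro l hl
    simp only [hμ _ l hl]
    refine ((hg.contDiffAt hl).continuousAt.tendsto).comp ?_
    have hsq : Tendsto (fun m : ℕ => l - l ^ 2 / ((m : ℝ) + 1)) atTop (𝓝 l) := by
      have h0 : Tendsto (fun m : ℕ => l ^ 2 / ((m : ℝ) + 1)) atTop (𝓝 0) :=
        tendsto_const_nhds.div_atTop (tendsto_atTop_add_const_right _ _ tendsto_natCast_atTop_atTop)
      simpa using h0.const_sub l
    refine tendsto_of_tendsto_of_tendsto_of_le_of_le' hsq tendsto_const_nhds ?_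
      (Eventually.of_forall (hsub l))
    filter_upwards [eventually_ge_atTop ⌈l⌉₊] with m hm
    have hm1 : (0 : ℝ) < m + 1 := by positivity
    have hlm : l / (m + 1) ≤ 1 := by
      rw [div_le_one hm1]
      exact (Nat.ceil_le.1 hm).trans (by linarith)
    have hlm0 : 0 < l / ((m : ℝ) + 1) := by positivity
    have habs := Real.abs_exp_sub_one_sub_id_le (x := -(l / (m + 1)))
      (by rw [abs_neg, abs_of_pos hlm0]; exact hlm)
    have h2 := (abs_le.1 habs).2
    have h3 : l / (m + 1) - (l / (m + 1)) ^ 2 ≤ 1 - Real.exp (-l / (m + 1)) := by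
      rw [neg_div, ← neg_sq (l / ((m : ℝ) + 1))]
      linarith
    calc l - l ^ 2 / ((m : ℝ) + 1) = (m + 1) * (l / (m + 1) - (l / (m + 1)) ^ 2) := by
          field_simp
      _ ≤ _ := mul_le_mul_of_nonneg_left h3 hm1.le
  have hae : ∀ m, ∀ᵐ s ∂(μ m : Measure ℝ), 0 ≤ s := fun m => by
    rw [ae_iff]
    convert hμ0 m using 2
    ext s; simp
  have hexp_int : ∀ (ρ : Measure ℝ) [IsFiniteMeasure ρ], (∀ᵐ s ∂ρ, 0 ≤ s) → ∀ l : ℝ, 0 < l →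
      Integrable (fun s => Real.exp (-l * s)) ρ := by
    intro ρ _ hρ l hl
    refine Integrable.of_bound (C := 1) (by fun_prop) (hρ.mono fun s hs => ?_)
    rw [Real.norm_of_nonneg (Real.exp_pos _).le, Real.exp_le_one_iff]
    nlinarith
  -- Markov's inequality for `1 - exp (-l s)`: this is at least `1 - exp (-1)` for `s ≥ 1 / l`, and
  -- its mean is at most `1 - g l` for every `m` because `g` is antitone. A small `l` makes the
  -- tails uniformly small.
  have htight : IsTightMeasureSet {((ρ : ProbabilityMeasure ℝ) : Measure ℝ) | ρ ∈ range μ} := by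
    rw [isTightMeasureSet_iff_exists_isCompact_measure_compl_le]
    intro ε hε
    have he1 : 0 < 1 - Real.exp (-1) := by
      rw [sub_pos, Real.exp_lt_one_iff]; norm_num
    obtain ⟨δ, hδ0, hδ⟩ : ∃ δ : ℝ, 0 < δ ∧ ENNReal.ofReal δ ≤ ε := by
      rcases eq_or_ne ε ⊤ with rfl | h
      · exact ⟨1, one_pos, le_top⟩
      · exact ⟨ε.toReal, ENNReal.toReal_pos hε.ne' h, by rw [ENNReal.ofReal_toReal h]⟩
    obtain ⟨l, hl0, hl⟩ : ∃ l : ℝ, 0 < l ∧ 1 - g l < δ * (1 - Real.exp (-1)) := by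
      have h2 : ∀ᶠ l in 𝓝[>] (0 : ℝ), 1 - g l < δ * (1 - Real.exp (-1)) := by
        have h3 : Tendsto (fun l => 1 - g l) (𝓝[>] 0) (𝓝 0) := by simpa using h1.const_sub 1
        exact h3.eventually_lt_const (by positivity)
      obtain ⟨l, h4, h5⟩ := (h2.and self_mem_nhdsWithin).exists
      exact ⟨l, h5, h4⟩
    refine ⟨Icc 0 l⁻¹, isCompact_Icc, ?_⟩
    rintro _ ⟨_, ⟨m, rfl⟩, rfl⟩
    have hmark := mul_meas_ge_le_integral_of_nonneg (μ := (μ m : Measure ℝ))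
      (f := fun s => 1 - Real.exp (-l * s))
      ((hae m).mono fun s hs => by
        simp only [Pi.zero_apply, sub_nonneg, Real.exp_le_one_iff]; nlinarith)
      ((integrable_const 1).sub (hexp_int _ (hae m) l hl0)) (1 - Real.exp (-1))
    rw [integral_sub (integrable_const 1) (hexp_int _ (hae m) l hl0), hμ m l hl0] at hmark
    simp only [integral_const, probReal_univ, smul_eq_mul, mul_one] at hmark
    have hgl : g l ≤ g (((m : ℝ) + 1) * (1 - Real.exp (-l / (m + 1)))) :=
      hg.antitoneOn (hpos l hl0 m) hl0 (hsub l m)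
    have hreal : (μ m : Measure ℝ).real {s | 1 - Real.exp (-1) ≤ 1 - Real.exp (-l * s)} ≤ δ := by
      refine le_of_mul_le_mul_left ?_ he1
      linarith
    refine le_trans ?_ hδ
    refine (measure_mono_ae (t := {s | 1 - Real.exp (-1) ≤ 1 - Real.exp (-l * s)}) ?_).trans ?_
    · filter_upwards [hae m] with s hs hsn
      have hsn' : l⁻¹ < s := by
        by_contra! hcon
        exact hsn ⟨hs, hcon⟩
      change 1 - Real.exp (-1) ≤ 1 - Real.exp (-l * s)
      have : 1 < l * s := by
        rw [inv_lt_iff_one_lt_mul₀ hl0] at hsn'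
        linarith
      have := Real.exp_le_exp.2 (show -l * s ≤ -1 by linarith)
      linarith
    · rw [← ofReal_measureReal]
      exact ENNReal.ofReal_le_ofReal hreal
  have hcpt := isCompact_closure_of_isTightMeasureSet htight
  obtain ⟨ν, -, hν⟩ := hcpt.exists_mapClusterPt (f := (atTop : Filter ℕ)) (u := μ)
    (le_principal_iff.2 (mem_map.2 (Eventually.of_forall fun m => subset_closure ⟨m, rfl⟩)))
  obtain ⟨U, hU, hUν⟩ := mapClusterPt_iff_ultrafilter.1 hν
  have hν0 : (ν : Measure ℝ) (Iio 0) = 0 := by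
    have := ProbabilityMeasure.le_liminf_measure_open_of_tendsto hUν isOpen_Iio (G := Iio (0 : ℝ))
    simpa [hμ0] using this
  have haeν : ∀ᵐ s ∂(ν : Measure ℝ), 0 ≤ s := by
    rw [ae_iff]
    convert hν0 using 2
    ext s; simp
  refine ⟨ν, inferInstance, hν0, fun l hl => ?_⟩
  -- Weak convergence needs a test function bounded on all of `ℝ`; the exponential is frozen on the
  -- negative axis, where the measures have no mass.
  let f : BoundedContinuousFunction ℝ ℝ := BoundedContinuousFunction.ofNormedAddCommGroup
    (fun s => Real.exp (-l * max s 0)) (by fun_prop) 1 fun s => by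
      rw [Real.norm_of_nonneg (Real.exp_pos _).le, Real.exp_le_one_iff]
      nlinarith [le_max_right s 0]
  have hf := (ProbabilityMeasure.tendsto_iff_forall_integral_tendsto.1 hUν) f
  have hfeq : ∀ ρ : Measure ℝ, (∀ᵐ s ∂ρ, 0 ≤ s) → ∫ s, f s ∂ρ = ∫ s, Real.exp (-l * s) ∂ρ :=
    fun ρ hρ => integral_congr_ae (hρ.mono fun s hs => by
      change Real.exp (-l * max s 0) = _
      rw [max_eq_left hs])
  rw [hfeq _ haeν] at hf
  simp only [fun m => hfeq _ (hae m)] at hf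
  exact tendsto_nhds_unique ((hlim l hl).mono_left hU) hf

end IsCompletelyMonotone

/-! ### Products and powers of Laplace transforms. -/

namespace IsLaplaceTransformOf

variable {g : ℝ → ℝ} {ν : Measure ℝ}

lemma ae_nonneg (h : IsLaplaceTransformOf g ν) : ∀ᵐ s ∂ν, 0 ≤ s := by
  rw [ae_iff]
  convert h.2.1 using 2
  ext s; simp

lemma integrable_exp (h : IsLaplaceTransformOf g ν) {z : ℝ} (hz : 0 ≤ z) :
    Integrable (fun s => Real.exp (-z * s)) ν := by
  have := h.1
  refine Integrable.of_bound (C := 1) (by fun_prop) (h.ae_nonneg.mono fun s hs => ?_)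
  rw [Real.norm_of_nonneg (Real.exp_pos _).le, Real.exp_le_one_iff]
  nlinarith

/-- The Laplace transform of a convolution is the product of the Laplace transforms. -/
lemma mul {f : ℝ → ℝ} {μ : Measure ℝ} (hf : IsLaplaceTransformOf f μ)
    (hg : IsLaplaceTransformOf g ν) :
    ∃ ρ : Measure ℝ, IsLaplaceTransformOf (fun z => f z * g z) ρ := by
  have := hf.1
  have := hg.1
  have hm : Measurable fun p : ℝ × ℝ => p.1 + p.2 := by fun_prop
  refine ⟨(μ.prod ν).map fun p => p.1 + p.2, inferInstance, ?_, fun z hz => ?_⟩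
  · rw [Measure.map_apply hm measurableSet_Iio]
    refine measure_mono_null (t := (Iio 0 ×ˢ univ) ∪ (univ ×ˢ Iio 0)) ?_ ?_
    · rintro ⟨a, b⟩ hab
      simp only [mem_preimage, mem_Iio] at hab
      rcases lt_or_ge a 0 with ha | ha
      · exact Or.inl ⟨ha, mem_univ _⟩
      · exact Or.inr ⟨mem_univ _, show b < 0 by linarith⟩
    · rw [measure_union_null_iff, Measure.prod_prod, Measure.prod_prod, hf.2.1, hg.2.1]
      simp
  · beta_reduce
    rw [integral_map hm.aemeasurable (by fun_prop), hf.2.2 z hz, hg.2.2 z hz,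
      ← integral_prod_mul]
    simp only [mul_add, Real.exp_add]

lemma exists_pow (h : IsLaplaceTransformOf g ν) (n : ℕ) :
    ∃ ρ : Measure ℝ, IsLaplaceTransformOf (fun z => g z ^ n) ρ := by
  induction n with
  | zero =>
    refine ⟨Measure.dirac 0, inferInstance, ?_, fun z _ => ?_⟩
    · simp [Measure.dirac_apply' _ measurableSet_Iio]
    · simp
  | succ n ih =>
    obtain ⟨ρ, hρ⟩ := ih
    obtain ⟨τ, hτ⟩ := hρ.mul h
    exact ⟨τ, by simpa only [pow_succ] using hτ⟩

end IsLaplaceTransformOf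

/-! ### Differentiation under the integral and passage to the limit at `0`. -/

namespace IsLaplaceTransformOf

variable {g : ℝ → ℝ} {ν : Measure ℝ}

/-- The Laplace transform at `z` is the moment generating function at `-z`, and in the interior of
its domain all damped moments exist and may be differentiated under the integral. -/
lemma mem_interior_integrableExpSet (h : IsLaplaceTransformOf g ν) {z : ℝ} (hz : 0 < z) :
    -z ∈ interior (ProbabilityTheory.integrableExpSet (fun s : ℝ => s) ν) := by
  refine interior_maximal (t := Iio 0) (fun w hw => ?_) isOpen_Iio (neg_lt_zero.2 hz)
  have := h.integrable_exp (z := -w) (neg_nonneg.2 (le_of_lt hw))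
  simpa [ProbabilityTheory.integrableExpSet] using this

lemma integrable_pow_mul_exp (h : IsLaplaceTransformOf g ν) {z : ℝ} (hz : 0 < z) (k : ℕ) :
    Integrable (fun s => s ^ k * Real.exp (-z * s)) ν :=
  ProbabilityTheory.integrable_pow_mul_exp_of_mem_interior_integrableExpSet
    (h.mem_interior_integrableExpSet hz) k

lemma hasDerivAt_integral_pow_mul_exp (h : IsLaplaceTransformOf g ν) {z : ℝ} (hz : 0 < z) (k : ℕ) :
    HasDerivAt (fun z => ∫ s, s ^ k * Real.exp (-z * s) ∂ν)
      (-∫ s, s ^ (k + 1) * Real.exp (-z * s) ∂ν) z := by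
  have h1 := ProbabilityTheory.hasDerivAt_integral_pow_mul_exp_real
    (h.mem_interior_integrableExpSet hz) k
  have h2 := h1.comp z (hasDerivAt_neg z)
  simpa [Function.comp_def] using h2

/-- If the damped integrals of `f ≥ 0` converge as the damping vanishes, then `f` is integrable and
its integral is the limit. -/
lemma integral_eq_of_tendsto (h : IsLaplaceTransformOf g ν) {f : ℝ → ℝ} (hf : Measurable f)
    (hf0 : ∀ s, 0 ≤ s → 0 ≤ f s)
    (hint : ∀ z : ℝ, 0 < z → Integrable (fun s => f s * Real.exp (-z * s)) ν) {L : ℝ}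
    (hL : Tendsto (fun z => ∫ s, f s * Real.exp (-z * s) ∂ν) (𝓝[>] 0) (𝓝 L)) :
    Integrable f ν ∧ ∫ s, f s ∂ν = L := by
  have hpt : ∀ s : ℝ, Tendsto (fun z : ℝ => f s * Real.exp (-z * s)) (𝓝[>] 0) (𝓝 (f s)) := by
    intro s
    have : Tendsto (fun z : ℝ => f s * Real.exp (-z * s)) (𝓝[>] 0)
        (𝓝 (f s * Real.exp (-0 * s))) := Continuous.continuousWithinAt (by fun_prop)
    simpa using this
  -- Integrability comes from Fatou's lemma; `f` itself then dominates the damped integrands.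
  have hI : Integrable f ν := by
    refine ⟨hf.aestronglyMeasurable, ?_⟩
    have hfatou : ∫⁻ s, ‖f s‖ₑ ∂ν ≤
        liminf (fun z => ∫⁻ s, ‖f s * Real.exp (-z * s)‖ₑ ∂ν) (𝓝[>] (0 : ℝ)) := by
      refine le_trans (lintegral_mono fun s => ?_) (lintegral_liminf_le' fun z => ?_)
      · exact (((hpt s).enorm).liminf_eq).ge
      · exact (Measurable.enorm (by fun_prop)).aemeasurable
    refine lt_of_le_of_lt hfatou ?_
    have heq : ∀ᶠ z in 𝓝[>] (0 : ℝ), ∫⁻ s, ‖f s * Real.exp (-z * s)‖ₑ ∂ν =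
        ENNReal.ofReal (∫ s, f s * Real.exp (-z * s) ∂ν) := by
      filter_upwards [self_mem_nhdsWithin] with z hz
      rw [ofReal_integral_eq_lintegral_ofReal (hint z hz)
        (h.ae_nonneg.mono fun s hs => mul_nonneg (hf0 s hs) (Real.exp_pos _).le)]
      refine lintegral_congr_ae (h.ae_nonneg.mono fun s hs => ?_)
      exact Real.enorm_of_nonneg (mul_nonneg (hf0 s hs) (Real.exp_pos _).le)
    rw [liminf_congr heq, (ENNReal.tendsto_ofReal hL).liminf_eq]
    exact ENNReal.ofReal_lt_top
  refine ⟨hI, ?_⟩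
  refine tendsto_nhds_unique ?_ hL
  refine tendsto_integral_filter_of_dominated_convergence (fun s => ‖f s‖)
    (Eventually.of_forall fun z => (by fun_prop : Measurable _).aestronglyMeasurable) ?_ hI.norm
    (ae_of_all _ hpt)
  filter_upwards [self_mem_nhdsWithin] with z hz
  filter_upwards [h.ae_nonneg] with s hs
  rw [norm_mul, Real.norm_of_nonneg (Real.exp_pos _).le]
  refine mul_le_of_le_one_right (norm_nonneg _) ?_
  rw [Real.exp_le_one_iff]
  have : 0 < z := hz
  nlinarith

lemma isProbabilityMeasure (h : IsLaplaceTransformOf g ν) (h1 : Tendsto g (𝓝[>] 0) (𝓝 1)) :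
    IsProbabilityMeasure ν := by
  have := h.1
  have h2 := (h.integral_eq_of_tendsto (f := fun _ => 1) measurable_const (fun _ _ => zero_le_one)
    (fun z hz => by simpa using h.integrable_exp hz.le) (L := 1)
    (h1.congr' (by filter_upwards [self_mem_nhdsWithin] with z hz; simp [h.2.2 z hz]))).2
  rw [integral_const, smul_eq_mul, mul_one] at h2
  exact ⟨(ENNReal.toReal_eq_one_iff _).1 h2⟩

end IsLaplaceTransformOf

/-! ### Mean and variance of the representing measure. -/

section Moments

variable {g : ℝ → ℝ} {c : ℝ} {n : ℕ} {ν : Measure ℝ}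

lemma IsNormalizedCM.hasDerivAt (hg : IsNormalizedCM g c) {z : ℝ} (hz : 0 < z) :
    HasDerivAt g (deriv g z) z :=
  ((hg.1.contDiffAt hz).differentiableAt (by simp)).hasDerivAt

lemma IsNormalizedCM.hasDerivAt_deriv (hg : IsNormalizedCM g c) {z : ℝ} (hz : 0 < z) :
    HasDerivAt (deriv g) (iteratedDeriv 2 g z) z := by
  rw [iteratedDeriv_succ, iteratedDeriv_one]
  have h1 : ContDiffOn ℝ 1 (deriv g) (Ioi 0) :=
    hg.1.1.deriv_of_isOpen isOpen_Ioi
      (by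
        rw [show (1 + 1 : WithTop ℕ∞) = ((2 : ℕ∞) : WithTop ℕ∞) by norm_num]
        exact_mod_cast le_top)
  exact ((h1.differentiableOn one_ne_zero).differentiableAt (Ioi_mem_nhds hz)).hasDerivAt

/-- The first two moments of the measure whose Laplace transform is `g ^ n`. -/
lemma IsNormalizedCM.moments_pow (hg : IsNormalizedCM g c)
    (hν : IsLaplaceTransformOf (fun z => g z ^ n) ν) :
    IsProbabilityMeasure ν ∧ (Integrable (fun s : ℝ => s) ν ∧ ∫ s, s ∂ν = n) ∧
      (Integrable (fun s : ℝ => s ^ 2) ν ∧ ∫ s, s ^ 2 ∂ν = n * (n - 1) + n * c) := by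
  have h0 : Tendsto (fun z => g z ^ n) (𝓝[>] 0) (𝓝 1) := by simpa using hg.2.1.pow n
  have hd1 : ∀ z : ℝ, 0 < z →
      ∫ s, s ^ 1 * Real.exp (-z * s) ∂ν = -(n * g z ^ (n - 1) * deriv g z) := by
    intro z hz
    have h1 := hν.hasDerivAt_integral_pow_mul_exp hz 0
    have h2 := (hg.hasDerivAt hz).fun_pow n
    have h3 : (fun z => ∫ s, s ^ 0 * Real.exp (-z * s) ∂ν) =ᶠ[𝓝 z] fun z => g z ^ n := by
      filter_upwards [Ioi_mem_nhds hz] with w hw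
      simp [hν.2.2 w hw]
    rw [← (h1.congr_of_eventuallyEq h3.symm).unique h2, neg_neg]
  have hd2 : ∀ z : ℝ, 0 < z → ∫ s, s ^ 2 * Real.exp (-z * s) ∂ν =
      n * ((n - 1 : ℕ) * g z ^ (n - 1 - 1) * deriv g z) * deriv g z +
        n * g z ^ (n - 1) * iteratedDeriv 2 g z := by
    intro z hz
    have h1 := hν.hasDerivAt_integral_pow_mul_exp hz 1
    have h2 := ((((hg.hasDerivAt hz).fun_pow (n - 1)).const_mul (n : ℝ)).fun_mul
      (hg.hasDerivAt_deriv hz)).fun_neg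
    have h3 : (fun z => ∫ s, s ^ 1 * Real.exp (-z * s) ∂ν) =ᶠ[𝓝 z]
        fun z => -(n * g z ^ (n - 1) * deriv g z) := by
      filter_upwards [Ioi_mem_nhds hz] with w hw
      exact hd1 w hw
    exact neg_injective ((h1.congr_of_eventuallyEq h3.symm).unique h2)
  refine ⟨hν.isProbabilityMeasure h0, ?_, ?_⟩
  · have hL : Tendsto (fun z => -(n * g z ^ (n - 1) * deriv g z)) (𝓝[>] 0)
        (𝓝 (-(n * 1 ^ (n - 1) * (-1)))) :=
      (((hg.2.1.pow (n - 1)).const_mul (n : ℝ)).mul hg.2.2.1).neg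
    have := hν.integral_eq_of_tendsto (f := fun s => s) measurable_id (fun s hs => hs)
      (fun z hz => by simpa using hν.integrable_pow_mul_exp hz 1) (L := n)
      (by
        refine (show (n : ℝ) = -(n * 1 ^ (n - 1) * (-1)) by simp) ▸ hL.congr' ?_
        filter_upwards [self_mem_nhdsWithin] with z hz
        rw [← hd1 z hz]; simp)
    exact this
  · have hL : Tendsto (fun z => n * ((n - 1 : ℕ) * g z ^ (n - 1 - 1) * deriv g z) * deriv g z +
        n * g z ^ (n - 1) * iteratedDeriv 2 g z) (𝓝[>] 0)
        (𝓝 (n * ((n - 1 : ℕ) * 1 ^ (n - 1 - 1) * (-1)) * (-1) + n * 1 ^ (n - 1) * c)) :=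
      (((((hg.2.1.pow (n - 1 - 1)).const_mul ((n - 1 : ℕ) : ℝ)).mul hg.2.2.1).const_mul
        (n : ℝ)).mul hg.2.2.1).add (((hg.2.1.pow (n - 1)).const_mul (n : ℝ)).mul hg.2.2.2)
    have hval : (n * ((n - 1 : ℕ) * 1 ^ (n - 1 - 1) * (-1)) * (-1) + n * 1 ^ (n - 1) * c : ℝ) =
        n * (n - 1) + n * c := by
      -- The truncated `n - 1` equals the real one except at `n = 0`, where the factor `n` kills the
      -- term.
      rcases n with _ | n
      · simp
      · push_cast; simp
    rw [hval] at hL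
    exact hν.integral_eq_of_tendsto (f := fun s => s ^ 2) (by fun_prop) (fun s _ => sq_nonneg s)
      (fun z hz => hν.integrable_pow_mul_exp hz 2) (hL.congr' (by
        filter_upwards [self_mem_nhdsWithin] with z hz
        rw [← hd2 z hz]))

/-- The measure of `g ^ n`, rescaled by `1 / n`, has mean `1` and variance `(c - 1) / n`. -/
lemma IsNormalizedCM.variance_pow (hg : IsNormalizedCM g c) (hn : 0 < n)
    (hν : IsLaplaceTransformOf (fun z => g z ^ n) ν) :
    ∫ s, (s / n - 1) ∂ν = 0 ∧ Integrable (fun s : ℝ => (s / n - 1) ^ 2) ν ∧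
      ∫ s, (s / n - 1) ^ 2 ∂ν = (c - 1) / n := by
  obtain ⟨hP, ⟨hi1, h1⟩, ⟨hi2, h2⟩⟩ := hg.moments_pow hν
  have hn' : (n : ℝ) ≠ 0 := by positivity
  have hexp : (fun s : ℝ => (s / n - 1) ^ 2) =
      fun s : ℝ => (s ^ 2 * (1 / n ^ 2) - s * (2 / n)) + 1 := by
    ext s; field_simp; ring
  have hia := hi2.mul_const (1 / (n : ℝ) ^ 2)
  have hib := hi1.mul_const (2 / (n : ℝ))
  refine ⟨?_, ?_, ?_⟩
  · rw [integral_sub (hi1.div_const _) (integrable_const _), integral_div, h1]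
    simp [hn']
  · rw [hexp]
    exact (hia.sub hib).add (integrable_const _)
  · rw [hexp, integral_add (f := fun s : ℝ => s ^ 2 * (1 / (n : ℝ) ^ 2) - s * (2 / n))
      (hia.sub hib) (integrable_const _), integral_sub hia hib,
      integral_mul_const, integral_mul_const, h1, h2]
    simp only [integral_const, probReal_univ, smul_eq_mul, mul_one]
    field_simp; ring

end Moments

/-! ### Taylor remainders at `1` for functions with singular derivatives at `0`. -/

section TaylorBounds

variable {E : Type*} [NormedAddCommGroup E] [NormedSpace ℝ E]

/-- A vector-valued function is bounded by a scalar one if its derivative is. -/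
lemma norm_le_of_hasDerivAt {f f' : ℝ → E} {B B' : ℝ → ℝ} {d : ℝ}
    (hf : ∀ v ∈ Icc 0 d, HasDerivAt f (f' v) v) (hB : ∀ v ∈ Icc 0 d, HasDerivAt B (B' v) v)
    (hf0 : f 0 = 0) (hB0 : B 0 = 0) (h : ∀ v ∈ Icc 0 d, ‖f' v‖ ≤ B' v) :
    ∀ v ∈ Icc 0 d, ‖f v‖ ≤ B v :=
  image_norm_le_of_norm_deriv_right_le_deriv_boundary'
    (fun v hv => (hf v hv).continuousAt.continuousWithinAt)
    (fun v hv => (hf v (Ico_subset_Icc_self hv)).hasDerivWithinAt) (by rw [hf0, hB0, norm_zero])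
    (fun v hv => (hB v hv).continuousAt.continuousWithinAt)
    (fun v hv => (hB v (Ico_subset_Icc_self hv)).hasDerivWithinAt)
    (fun v hv => h v (Ico_subset_Icc_self hv))

variable {W W₁ W₂ : ℝ → E}

/-- The signs model `W u = e^{-uA} x`, `W₁ u = A e^{-uA} x`, `W₂ u = A² e^{-uA} x`. -/
lemma hasDerivAt_taylor_right (hW : ∀ u, 0 < u → HasDerivAt W (-W₁ u) u) {v : ℝ} (hv : 0 < 1 + v) :
    HasDerivAt (fun v => W (1 + v) - W 1 + v • W₁ 1) (-W₁ (1 + v) + W₁ 1) v := by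
  have h1 := (hW (1 + v) hv).scomp v ((hasDerivAt_id v).const_add 1)
  have h2 := (h1.sub_const (W 1)).fun_add ((hasDerivAt_id v).smul_const (W₁ 1))
  simpa using h2

lemma hasDerivAt_taylor_left (hW : ∀ u, 0 < u → HasDerivAt W (-W₁ u) u) {v : ℝ} (hv : 0 < 1 - v) :
    HasDerivAt (fun v => W (1 - v) - W 1 - v • W₁ 1) (W₁ (1 - v) - W₁ 1) v := by
  have h1 := (hW (1 - v) hv).scomp v ((hasDerivAt_id v).const_sub 1)
  have h2 := (h1.sub_const (W 1)).fun_sub ((hasDerivAt_id v).smul_const (W₁ 1))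
  simpa using h2

/-- Second-order Taylor bound to the right of `1`. -/
lemma norm_taylor_le_of_one_le (hW : ∀ u, 0 < u → HasDerivAt W (-W₁ u) u)
    (hW₁ : ∀ u, 0 < u → HasDerivAt W₁ (-W₂ u) u) {m : ℝ}
    (hm : ∀ u, 1 ≤ u → ‖W₂ u‖ ≤ m) {s : ℝ} (hs : 1 ≤ s) :
    ‖W s - W 1 + (s - 1) • W₁ 1‖ ≤ m / 2 * (s - 1) ^ 2 := by
  have hB1 : ∀ v : ℝ, HasDerivAt (fun v => m * v) m v := fun v => by
    simpa using (hasDerivAt_id v).const_mul m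
  have hB : ∀ v : ℝ, HasDerivAt (fun v => m / 2 * v ^ 2) (m * v) v := fun v => by
    have := (hasDerivAt_pow 2 v).const_mul (m / 2)
    refine this.congr_deriv ?_
    push_cast; ring
  have h1 : ∀ v ∈ Icc 0 (s - 1), ‖-W₁ (1 + v) + W₁ 1‖ ≤ m * v := by
    refine norm_le_of_hasDerivAt (f' := fun v => W₂ (1 + v)) (fun v hv => ?_)
      (fun v _ => hB1 v) (by simp) (by simp) fun v hv => hm _ (by linarith [hv.1])
    have := (hW₁ (1 + v) (by linarith [hv.1])).scomp v ((hasDerivAt_id v).const_add 1)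
    simpa using this.neg.add_const (W₁ 1)
  have h2 := norm_le_of_hasDerivAt (d := s - 1)
    (fun v hv => hasDerivAt_taylor_right hW (v := v) (by linarith [hv.1]))
    (fun v _ => hB v) (by simp) (by simp) h1 (s - 1) ⟨by linarith, le_rfl⟩
  simpa using h2

lemma hasDerivAt_neg_log_one_sub {v : ℝ} (hv : 0 < 1 - v) :
    HasDerivAt (fun v => -Real.log (1 - v)) (1 / (1 - v)) v := by
  have := (((hasDerivAt_id v).const_sub 1).log hv.ne').fun_neg
  simpa [neg_div] using this

/-- Second-order Taylor bound to the left of `1`, for a second derivative of size `u ^ (-2)`. -/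
lemma norm_taylor_le_of_norm_le_div_sq (hW : ∀ u, 0 < u → HasDerivAt W (-W₁ u) u)
    (hW₁ : ∀ u, 0 < u → HasDerivAt W₁ (-W₂ u) u) {m : ℝ}
    (hm : ∀ u, 0 < u → ‖W₂ u‖ ≤ m / u ^ 2) {s : ℝ} (hs : 0 < s) (hs1 : s ≤ 1) :
    ‖W s - W 1 + (s - 1) • W₁ 1‖ ≤ m * (-Real.log s - (1 - s)) := by
  have hpos : ∀ v ∈ Icc 0 (1 - s), 0 < 1 - v := fun v hv => by linarith [hv.2]
  have hB1 : ∀ v ∈ Icc 0 (1 - s),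
      HasDerivAt (fun v => m * (1 / (1 - v) - 1)) (m / (1 - v) ^ 2) v := fun v hv => by
    have := ((((hasDerivAt_id v).const_sub 1).fun_inv (hpos v hv).ne').sub_const 1).const_mul m
    simpa [div_eq_mul_inv] using this
  have hB : ∀ v ∈ Icc 0 (1 - s),
      HasDerivAt (fun v => m * (-Real.log (1 - v) - v)) (m * (1 / (1 - v) - 1)) v := fun v hv =>
    ((hasDerivAt_neg_log_one_sub (hpos v hv)).sub (hasDerivAt_id v)).const_mul m
  have h1 : ∀ v ∈ Icc 0 (1 - s), ‖W₁ (1 - v) - W₁ 1‖ ≤ m * (1 / (1 - v) - 1) := by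
    refine norm_le_of_hasDerivAt (f' := fun v => W₂ (1 - v)) (fun v hv => ?_)
      hB1 (by simp) (by simp) fun v hv => hm _ (hpos v hv)
    have := (hW₁ (1 - v) (hpos v hv)).scomp v ((hasDerivAt_id v).const_sub 1)
    simpa using this.sub_const (W₁ 1)
  have h2 := norm_le_of_hasDerivAt (d := 1 - s)
    (fun v hv => hasDerivAt_taylor_left hW (v := v) (hpos v hv))
    hB (by simp) (by simp) h1 (1 - s) ⟨by linarith, le_rfl⟩
  rw [sub_sub_cancel] at h2
  rwa [← neg_sub 1 s, neg_smul, ← sub_eq_add_neg]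

/-- Second-order Taylor bound for a second derivative of size `u ^ (-1)`. -/
lemma norm_taylor_le_of_norm_le_div (hW : ∀ u, 0 < u → HasDerivAt W (-W₁ u) u)
    (hW₁ : ∀ u, 0 < u → HasDerivAt W₁ (-W₂ u) u) {m : ℝ}
    (hm : ∀ u, 0 < u → ‖W₂ u‖ ≤ m / u) {s : ℝ} (hs : 0 < s) :
    ‖W s - W 1 + (s - 1) • W₁ 1‖ ≤ m * (s - 1) ^ 2 := by
  have hm0 : 0 ≤ m := by simpa using (norm_nonneg _).trans (hm 1 one_pos)
  rcases le_total 1 s with hs1 | hs1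
  · refine (norm_taylor_le_of_one_le hW hW₁ (m := m) (fun u hu => ?_) hs1).trans ?_
    · exact (hm u (by linarith)).trans (div_le_self hm0 hu)
    · nlinarith [mul_nonneg hm0 (sq_nonneg (s - 1))]
  have hpos : ∀ v ∈ Icc 0 (1 - s), 0 < 1 - v := fun v hv => by linarith [hv.2]
  have hB1 : ∀ v ∈ Icc 0 (1 - s),
      HasDerivAt (fun v => m * (-Real.log (1 - v))) (m / (1 - v)) v := fun v hv => by
    simpa [div_eq_mul_inv] using (hasDerivAt_neg_log_one_sub (hpos v hv)).const_mul m
  have hB : ∀ v ∈ Icc 0 (1 - s), HasDerivAt (fun v => m * ((1 - v) * Real.log (1 - v) + v))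
      (m * (-Real.log (1 - v))) v := fun v hv => by
    have hv' := (hpos v hv).ne'
    have h1 := (((hasDerivAt_id v).const_sub 1).fun_mul
      (((hasDerivAt_id v).const_sub 1).log hv')).fun_add (hasDerivAt_id v)
    refine (h1.const_mul m).congr_deriv ?_
    simp only [id]
    field_simp
    ring
  have h1 : ∀ v ∈ Icc 0 (1 - s), ‖W₁ (1 - v) - W₁ 1‖ ≤ m * (-Real.log (1 - v)) := by
    refine norm_le_of_hasDerivAt (f' := fun v => W₂ (1 - v)) (fun v hv => ?_)
      hB1 (by simp) (by simp) fun v hv => hm _ (hpos v hv)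
    have := (hW₁ (1 - v) (hpos v hv)).scomp v ((hasDerivAt_id v).const_sub 1)
    simpa using this.sub_const (W₁ 1)
  have h2 := norm_le_of_hasDerivAt (d := 1 - s)
    (fun v hv => hasDerivAt_taylor_left hW (v := v) (hpos v hv))
    hB (by simp) (by simp) h1 (1 - s) ⟨by linarith, le_rfl⟩
  rw [sub_sub_cancel] at h2
  rw [← neg_sub 1 s, neg_smul, ← sub_eq_add_neg, neg_sq]
  -- Integrating `1 / u` twice leaves `s log s + 1 - s`, and `log s ≤ s - 1` turns this into `(s -
  -- 1) ^ 2`.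
  refine h2.trans (mul_le_mul_of_nonneg_left ?_ hm0)
  have := Real.log_le_sub_one_of_pos hs
  nlinarith

/-- First-order bound to the left of `1`, for a derivative of size `u ^ (-1)`. -/
lemma norm_sub_le_of_norm_le_div (hW : ∀ u, 0 < u → HasDerivAt W (-W₁ u) u) {m : ℝ}
    (hm : ∀ u, 0 < u → ‖W₁ u‖ ≤ m / u) {s : ℝ} (hs : 0 < s) (hs1 : s ≤ 1) :
    ‖W s - W 1‖ ≤ m * (-Real.log s) := by
  have hpos : ∀ v ∈ Icc 0 (1 - s), 0 < 1 - v := fun v hv => by linarith [hv.2]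
  have h := norm_le_of_hasDerivAt (d := 1 - s) (f := fun v => W (1 - v) - W 1)
    (f' := fun v => W₁ (1 - v)) (B := fun v => m * (-Real.log (1 - v)))
    (B' := fun v => m / (1 - v)) (fun v hv => by
      have := (hW (1 - v) (hpos v hv)).scomp v ((hasDerivAt_id v).const_sub 1)
      simpa using this.sub_const (W 1))
    (fun v hv => by
      simpa [div_eq_mul_inv] using (hasDerivAt_neg_log_one_sub (hpos v hv)).const_mul m)
    (by simp) (by simp) (fun v hv => hm _ (hpos v hv)) (1 - s) ⟨by linarith, le_rfl⟩
  simpa using h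

/-- This is `x ≤ sinh x` at `x = -log r`. -/
lemma neg_log_le_inv_sqrt_sub_sqrt {r : ℝ} (hr : 0 < r) (hr1 : r ≤ 1) :
    -Real.log (r ^ 2) ≤ 1 / r - r := by
  have h0 : 0 ≤ Real.log r⁻¹ := Real.log_nonneg (one_le_inv₀ hr |>.2 hr1)
  have h := Real.self_le_sinh_iff.2 h0
  rw [Real.sinh_log (inv_pos.2 hr), inv_inv, Real.log_inv] at h
  rw [Real.log_pow, one_div]
  push_cast
  linarith

/-- The scalar inequality behind `norm_taylor_le`: away from `0`, a suitable convex combination of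
the first-order and the second-order bound is quadratic in `1 - s`. -/
lemma le_quadratic_of_le_log {N m₁ m₂ s : ℝ} (hm₁ : 0 ≤ m₁) (hm₂ : 0 ≤ m₂)
    (hs : 4 / 25 ≤ s) (hs1 : s < 1) (h₁ : N ≤ m₁ * (-Real.log s + (1 - s)))
    (h₂ : N ≤ m₂ * (-Real.log s - (1 - s))) :
    N ≤ (3 * m₁ + m₂ / 2) * (1 - s) ^ 2 := by
  set d := 1 - s with hd
  set b := -Real.log s - d with hb
  have hd0 : 0 < d := by simp only [hd]; linarith
  have hb0 : 0 ≤ b := by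
    have := Real.log_le_sub_one_of_pos (show 0 < s by linarith)
    simp only [hb, hd]; linarith
  have h₁' : N ≤ m₁ * (b + 2 * d) := by rw [hb]; convert h₁ using 2; ring
  -- The series of the logarithm gives `b ≥ d ^ 2 / 2`; the case split makes proving it unnecessary.
  rcases le_total b (d ^ 2 / 2) with hbd | hbd
  · have h3 : m₂ * b ≤ m₂ * (d ^ 2 / 2) := mul_le_mul_of_nonneg_left hbd hm₂
    nlinarith [mul_nonneg hm₁ (sq_nonneg d)]
  have hbpos : 0 < b := lt_of_lt_of_le (by positivity) hbd
  obtain ⟨r, hr0, hrs⟩ : ∃ r : ℝ, 0 < r ∧ r ^ 2 = s :=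
    ⟨√s, Real.sqrt_pos.2 (by linarith), Real.sq_sqrt (by linarith)⟩
  have hr : 2 / 5 ≤ r := by nlinarith
  have hr1 : r < 1 := by nlinarith
  -- An expanded form of `(b + 2 d) (b - d ^ 2 / 2) ≤ 3 d ^ 2 b`, the source of the constant `3`
  -- before `m₁`.
  have hquad : b ^ 2 + b * (2 * d - 7 / 2 * d ^ 2) ≤ d ^ 3 := by
    have hlog := neg_log_le_inv_sqrt_sub_sqrt hr0 hr1.le
    rw [hrs] at hlog
    have hdr : d = 1 - r ^ 2 := by rw [hrs]
    have hbq : b ≤ d * ((1 - r) / r) := by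
      have : 1 / r - r - d = d * ((1 - r) / r) := by rw [hdr]; field_simp
      rw [← this]; simp only [hb]; linarith
    set q := (1 - r) / r with hq
    have hq0 : 0 < q := div_pos (by linarith) hr0
    have hqr : q * r = 1 - r := by rw [hq]; field_simp
    have hkey : q * (q + 2 - 7 / 2 * d) ≤ d := by
      -- The factor `1 - 5 r / 2` is nonpositive exactly for `r ≥ 2 / 5`, that is `s ≥ 4 / 25`: the
      -- threshold in the hypotheses.
      have h3 : q * (q + 2 - 7 / 2 * d) - d = (1 - r) * (1 - r ^ 2) * (1 - 5 / 2 * r) / r ^ 2 := by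
        rw [hq, hdr]; field_simp; ring
      have h4 : (1 - r) * (1 - r ^ 2) * (1 - 5 / 2 * r) / r ^ 2 ≤ 0 := by
        refine div_nonpos_of_nonpos_of_nonneg ?_ (by positivity)
        refine mul_nonpos_of_nonneg_of_nonpos ?_ (by linarith)
        exact mul_nonneg (by linarith) (by nlinarith)
      linarith
    have h5 : b ^ 2 + b * (2 * d - 7 / 2 * d ^ 2) ≤ b * (d * (q + 2 - 7 / 2 * d)) := by
      nlinarith
    rcases le_total 0 (q + 2 - 7 / 2 * d) with h6 | h6
    · have h7 : b * (d * (q + 2 - 7 / 2 * d)) ≤ d * q * (d * (q + 2 - 7 / 2 * d)) :=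
        mul_le_mul_of_nonneg_right hbq (mul_nonneg hd0.le h6)
      have h8 : d * q * (d * (q + 2 - 7 / 2 * d)) = d ^ 2 * (q * (q + 2 - 7 / 2 * d)) := by ring
      nlinarith [mul_le_mul_of_nonneg_left hkey (sq_nonneg d)]
    · have h7 : b * (d * (q + 2 - 7 / 2 * d)) ≤ 0 :=
        mul_nonpos_of_nonneg_of_nonpos hb0 (mul_nonpos_of_nonneg_of_nonpos hd0.le h6)
      have : 0 < d ^ 3 := by positivity
      linarith
  -- The first bound gets weight `1 - d ^ 2 / (2 b)` and the second `d ^ 2 / (2 b)`, so that the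
  -- second contributes exactly `m₂ d ^ 2 / 2`; everything is multiplied by `b`.
  have hfin : N * b ≤ (3 * m₁ + m₂ / 2) * d ^ 2 * b := by
    have h3 : N * (b - d ^ 2 / 2) ≤ m₁ * (b + 2 * d) * (b - d ^ 2 / 2) :=
      mul_le_mul_of_nonneg_right h₁' (by linarith)
    have h4 : N * (d ^ 2 / 2) ≤ m₂ * b * (d ^ 2 / 2) :=
      mul_le_mul_of_nonneg_right h₂ (by positivity)
    have h5 : m₁ * ((b + 2 * d) * (b - d ^ 2 / 2)) ≤ m₁ * (3 * d ^ 2 * b) :=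
      mul_le_mul_of_nonneg_left (by nlinarith) hm₁
    nlinarith
  exact le_of_mul_le_mul_right hfin hbpos

/-- The second-order Taylor bound at `1` with a remainder that is quadratic up to `0`. -/
lemma norm_taylor_le (hW : ∀ u, 0 < u → HasDerivAt W (-W₁ u) u)
    (hW₁ : ∀ u, 0 < u → HasDerivAt W₁ (-W₂ u) u) {m₀ m₁ m₂ : ℝ}
    (h₀ : ∀ u, 0 ≤ u → ‖W u‖ ≤ m₀) (h₁ : ∀ u, 0 < u → ‖W₁ u‖ ≤ m₁ / u)
    (h₂ : ∀ u, 0 < u → ‖W₂ u‖ ≤ m₂ / u ^ 2) {s : ℝ} (hs : 0 ≤ s) :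
    ‖W s - W 1 + (s - 1) • W₁ 1‖ ≤ (3 * m₀ + 3 * m₁ + m₂ / 2) * (s - 1) ^ 2 := by
  have hm₀ : 0 ≤ m₀ := (norm_nonneg _).trans (h₀ 0 le_rfl)
  have hm₁ : 0 ≤ m₁ := by simpa using (norm_nonneg _).trans (h₁ 1 one_pos)
  have hm₂ : 0 ≤ m₂ := by simpa using (norm_nonneg _).trans (h₂ 1 one_pos)
  have hsq := sq_nonneg (s - 1)
  rcases le_or_gt 1 s with hs1 | hs1
  · refine (norm_taylor_le_of_one_le hW hW₁ (m := m₂) (fun u hu => ?_) hs1).trans ?_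
    · exact (h₂ u (by linarith)).trans (div_le_self hm₂ (one_le_pow₀ hu))
    · nlinarith [mul_nonneg hm₀ hsq, mul_nonneg hm₁ hsq]
  have hW11 : ‖(s - 1) • W₁ 1‖ ≤ m₁ * (1 - s) := by
    rw [norm_smul, Real.norm_of_nonpos (by linarith), neg_sub, mul_comm]
    exact mul_le_mul_of_nonneg_right (by simpa using h₁ 1 one_pos) (by linarith)
  -- Below the threshold `3 (s - 1) ^ 2 ≥ 2`, so the triangle inequality suffices.
  rcases lt_or_ge s (4 / 25) with hs2 | hs2
  · have hb : ‖W s - W 1 + (s - 1) • W₁ 1‖ ≤ m₀ + m₀ + m₁ * (1 - s) :=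
      norm_add_le_of_le (norm_sub_le_of_le (h₀ s hs) (h₀ 1 zero_le_one)) hW11
    have h3 : 2 ≤ 3 * (s - 1) ^ 2 := by nlinarith
    have h4 : 1 - s ≤ 3 * (s - 1) ^ 2 := by nlinarith
    nlinarith [mul_nonneg hm₂ hsq, mul_le_mul_of_nonneg_left h3 hm₀,
      mul_le_mul_of_nonneg_left h4 hm₁]
  · have hs0 : 0 < s := by linarith
    have hb := le_quadratic_of_le_log hm₁ hm₂ hs2 hs1
      (N := ‖W s - W 1 + (s - 1) • W₁ 1‖) (by
        refine (norm_add_le_of_le (norm_sub_le_of_norm_le_div hW h₁ hs0 hs1.le) hW11).trans_eq ?_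
        ring) (norm_taylor_le_of_norm_le_div_sq hW hW₁ h₂ hs0 hs1.le)
    rw [← neg_sub 1 s, neg_sq] at hsq ⊢
    rw [neg_sub 1 s]
    nlinarith [mul_nonneg hm₀ hsq]

end TaylorBounds

/-! ### Derivatives of the holomorphic semigroup and the constants `M_k`. -/

section Semigroup

variable {X : Type*} [NormedAddCommGroup X] [NormedSpace ℂ X] {T : ℝ → X →L[ℂ] X}

lemma hasDerivAt_apply {F : ℝ → X →L[ℂ] X} {F' : X →L[ℂ] X} {t : ℝ} (h : HasDerivAt F F' t)
    (x : X) : HasDerivAt (fun u => F u x) (F' x) t :=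
  ((ContinuousLinearMap.apply ℂ X x).restrictScalars ℝ).hasFDerivAt.comp_hasDerivAt t h

lemma OpGraph.unique {x y z : X} (h₁ : OpGraph T x y) (h₂ : OpGraph T x z) : y = z :=
  tendsto_nhds_unique h₁ h₂

lemma OpPowGraph.unique {k : ℕ} {x y z : X} (h₁ : OpPowGraph T k x y) (h₂ : OpPowGraph T k x z) :
    y = z := by
  induction k generalizing x with
  | zero => exact (show x = y from h₁).symm.trans h₂
  | succ k ih =>
    obtain ⟨v, hv, hvy⟩ := h₁
    obtain ⟨w, hw, hwz⟩ := h₂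
    obtain rfl := hv.unique hw
    exact ih hvy hwz

lemma IsPowSemigroup.unique {k : ℕ} {t : ℝ} {B C : X →L[ℂ] X} (hB : IsPowSemigroup T k t B)
    (hC : IsPowSemigroup T k t C) : B = C :=
  ContinuousLinearMap.ext fun x => (hB x).unique (hC x)

lemma norm_mem_powNorms {k : ℕ} {t : ℝ} (ht : 0 < t) {B : X →L[ℂ] X}
    (hB : IsPowSemigroup T k t B) : t ^ k * ‖B‖ ∈ powNorms T k :=
  ⟨t, ht, B, hB, by rw [norm_smul, Real.norm_of_nonneg (by positivity)]⟩

lemma bddAbove_powNorms {k : ℕ} {F : ℝ → X →L[ℂ] X} (hF : ∀ t, 0 < t → IsPowSemigroup T k t (F t))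
    {C : ℝ} (hC : ∀ t, 0 < t → t ^ k * ‖F t‖ ≤ C) : BddAbove (powNorms T k) := by
  refine ⟨C, ?_⟩
  rintro _ ⟨t, ht, B, hB, rfl⟩
  rw [hB.unique (hF t ht), norm_smul, Real.norm_of_nonneg (by positivity)]
  exact hC t ht

lemma norm_le_supM_div {k : ℕ} (hbdd : BddAbove (powNorms T k)) {t : ℝ} (ht : 0 < t)
    {B : X →L[ℂ] X} (hB : IsPowSemigroup T k t B) : ‖B‖ ≤ supM T k / t ^ k := by
  rw [le_div_iff₀' (by positivity)]
  exact le_csSup hbdd (norm_mem_powNorms ht hB)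

namespace IsSectoriallyBoundedHolomorphic

/-- On the positive axis the semigroup is differentiable, with a bound from Cauchy's estimate. -/
lemma exists_norm_deriv_le (h : IsSectoriallyBoundedHolomorphic T) :
    ∃ C : ℝ, ∀ t : ℝ, 0 < t → DifferentiableAt ℝ T t ∧ t * ‖deriv T t‖ ≤ C := by
  obtain ⟨θ, ⟨hθ0, -⟩, S, hST, hS, hbd⟩ := h
  obtain ⟨⟨C, hC⟩, -⟩ := hbd (θ / 2) ⟨by linarith, by linarith⟩
  -- A disc about `1` inside the sector, dilated by `t > 0`, stays in the sector; Cauchy's estimate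
  -- on radius `t ρ` gives the decay `1 / t`.
  obtain ⟨ρ, hρ0, hρ⟩ : ∃ ρ : ℝ, 0 < ρ ∧
      ∀ w : ℂ, w ∈ Metric.closedBall 1 ρ → w ≠ 0 ∧ |w.arg| ≤ θ / 2 := by
    have h1 : ∀ᶠ w in 𝓝 (1 : ℂ), |w.arg| < θ / 2 := by
      have h2 : ContinuousAt (fun w : ℂ => |w.arg|) 1 :=
        (Complex.continuousAt_arg Complex.one_mem_slitPlane).abs
      exact h2.eventually_lt_const (by simpa using hθ0)
    have h2 : ∀ᶠ w in 𝓝 (1 : ℂ), w ≠ 0 := isOpen_ne.mem_nhds one_ne_zero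
    obtain ⟨ρ, hρ0, hρ⟩ := Metric.nhds_basis_closedBall.mem_iff.1 (h2.and h1)
    exact ⟨ρ, hρ0, fun w hw => ⟨(hρ hw).1, (hρ hw).2.le⟩⟩
  refine ⟨C / ρ, fun t ht => ?_⟩
  have hball : ∀ z ∈ Metric.closedBall (t : ℂ) (t * ρ), z ≠ 0 ∧ |z.arg| ≤ θ / 2 := by
    intro z hz
    have htc : (t : ℂ) ≠ 0 := by exact_mod_cast ht.ne'
    have hz' : z = t * (z / t) := by field_simp
    have hw := hρ (z / t) (by
      rw [Metric.mem_closedBall, dist_eq_norm] at hz ⊢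
      have : z / t - 1 = (z - t) / t := by field_simp
      rw [this, norm_div, Complex.norm_real, Real.norm_of_nonneg ht.le, div_le_iff₀ ht]
      linarith)
    refine ⟨fun h0 => hw.1 (by simp [h0]), ?_⟩
    rw [hz', Complex.arg_real_mul _ ht]
    exact hw.2
  have hr : 0 < t * ρ := mul_pos ht hρ0
  have hsub : Metric.closedBall (t : ℂ) (t * ρ) ⊆ {z : ℂ | z ≠ 0 ∧ |z.arg| < θ} :=
    fun z hz => ⟨(hball z hz).1, (hball z hz).2.trans_lt (by linarith)⟩
  have hdiff : DifferentiableAt ℂ S (t : ℂ) :=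
    (hS.mono hsub).differentiableAt (Metric.closedBall_mem_nhds _ hr)
  have hder : HasDerivAt T (deriv S t) t := by
    have h1 : HasDerivAt (fun u : ℝ => S u) (deriv S t) t := by
      simpa [Function.comp_def] using hdiff.hasDerivAt.scomp t (hasDerivAt_id t).ofReal_comp
    refine h1.congr_of_eventuallyEq ?_
    filter_upwards [Ioi_mem_nhds ht] with u hu
    exact (hST u (le_of_lt hu)).symm
  refine ⟨hder.differentiableAt, ?_⟩
  rw [hder.deriv]
  have hcauchy := Complex.norm_deriv_le_of_forall_mem_sphere_norm_le hr
    ((hS.mono hsub).diffContOnCl_ball subset_rfl)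
    fun z hz => hC z (hball z (Metric.sphere_subset_closedBall hz)).2
  calc t * ‖deriv S t‖ ≤ t * (C / (t * ρ)) := by gcongr
    _ = C / ρ := by field_simp

lemma exists_norm_le (h : IsSectoriallyBoundedHolomorphic T) :
    ∃ C : ℝ, ∀ t : ℝ, 0 ≤ t → ‖T t‖ ≤ C := by
  obtain ⟨θ, ⟨hθ0, -⟩, S, hST, hS, hbd⟩ := h
  obtain ⟨⟨C, hC⟩, -⟩ := hbd (θ / 2) ⟨by linarith, by linarith⟩
  refine ⟨C, fun t ht => ?_⟩
  rw [← hST t ht]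
  refine hC _ ?_
  rw [Complex.arg_ofReal_of_nonneg ht, abs_zero]
  linarith

lemma continuousOn (h : IsSectoriallyBoundedHolomorphic T) (x : X) :
    ContinuousOn (fun t => T t x) (Ici 0) := by
  obtain ⟨θ, ⟨hθ0, -⟩, S, hST, hS, hbd⟩ := h
  obtain ⟨-, hcont⟩ := hbd (θ / 2) ⟨by linarith, by linarith⟩
  have h1 : ContinuousOn (fun t : ℝ => S t x) (Ici 0) :=
    (hcont x).comp Complex.continuous_ofReal.continuousOn fun t ht => by
      change |(t : ℂ).arg| ≤ θ / 2
      rw [Complex.arg_ofReal_of_nonneg ht, abs_zero]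
      linarith
  exact h1.congr fun t ht => by simp only [hST t ht]

lemma hasDerivAt (h : IsSectoriallyBoundedHolomorphic T) {t : ℝ} (ht : 0 < t) :
    HasDerivAt T (deriv T t) t := by
  obtain ⟨C, hC⟩ := h.exists_norm_deriv_le
  exact (hC t ht).1.hasDerivAt

end IsSectoriallyBoundedHolomorphic

/-- The operator `A e^{-tA}`, as minus the derivative of the semigroup. -/
noncomputable def genMul (T : ℝ → X →L[ℂ] X) (t : ℝ) : X →L[ℂ] X := -deriv T t

/-- The operator `A ^ 2 e^{-tA}`. -/
noncomputable def genSqMul (T : ℝ → X →L[ℂ] X) (t : ℝ) : X →L[ℂ] X :=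
  (genMul T (t / 2)).comp (genMul T (t / 2))

lemma IsSectoriallyBoundedHolomorphic.hasDerivAt_genMul (h : IsSectoriallyBoundedHolomorphic T)
    {t : ℝ} (ht : 0 < t) : HasDerivAt T (-genMul T t) t := by
  rw [genMul, neg_neg]; exact h.hasDerivAt ht

lemma IsSectoriallyBoundedHolomorphic.exists_norm_genMul_le
    (h : IsSectoriallyBoundedHolomorphic T) :
    ∃ C : ℝ, ∀ t : ℝ, 0 < t → t * ‖genMul T t‖ ≤ C := by
  obtain ⟨C, hC⟩ := h.exists_norm_deriv_le
  exact ⟨C, fun t ht => by rw [genMul, norm_neg]; exact (hC t ht).2⟩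

namespace IsC0Semigroup

lemma comm (hT : IsC0Semigroup T) {s t : ℝ} (hs : 0 ≤ s) (ht : 0 ≤ t) :
    (T s).comp (T t) = (T t).comp (T s) := by
  rw [← hT.map_add s t hs ht, add_comm, hT.map_add t s ht hs]

lemma apply_add (hT : IsC0Semigroup T) {s t : ℝ} (hs : 0 ≤ s) (ht : 0 ≤ t) (x : X) :
    T (s + t) x = T s (T t x) := by rw [hT.map_add s t hs ht]; rfl

/-- The closed operator `A` commutes with the semigroup. -/
lemma opGraph_apply (hT : IsC0Semigroup T) {s : ℝ} (hs : 0 ≤ s) {x y : X} (h : OpGraph T x y) :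
    OpGraph T (T s x) (T s y) := by
  refine (((T s).continuous.tendsto y).comp h).congr' ?_
  filter_upwards [self_mem_nhdsWithin] with u hu
  rw [Function.comp_apply, (T s).map_smul_of_tower, map_sub,
    ← hT.apply_add hs (le_of_lt hu), add_comm, hT.apply_add (le_of_lt hu) hs]

lemma opGraph_genMul (hT : IsC0Semigroup T) (hol : IsSectoriallyBoundedHolomorphic T) {t : ℝ}
    (ht : 0 < t) (x : X) : OpGraph T (T t x) (genMul T t x) := by
  have h1 : HasDerivAt (fun u => T u x) (-genMul T t x) t :=
    hasDerivAt_apply (hol.hasDerivAt_genMul ht) x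
  have h2 := (h1.tendsto_slope_zero_right).neg
  rw [neg_neg] at h2
  refine h2.congr' ?_
  filter_upwards [self_mem_nhdsWithin] with u hu
  rw [add_comm, hT.apply_add (le_of_lt hu) ht.le, ← smul_neg, neg_sub]

lemma genMul_apply_of_opGraph (hT : IsC0Semigroup T) (hol : IsSectoriallyBoundedHolomorphic T)
    {t : ℝ} (ht : 0 < t) {x y : X} (h : OpGraph T x y) : genMul T t x = T t y :=
  (hT.opGraph_genMul hol ht x).unique (hT.opGraph_apply ht.le h)

lemma genMul_add_apply (hT : IsC0Semigroup T) (hol : IsSectoriallyBoundedHolomorphic T)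
    {s t : ℝ} (hs : 0 ≤ s) (ht : 0 < t) (x : X) : genMul T (s + t) x = T s (genMul T t x) := by
  have h := hT.opGraph_apply hs (hT.opGraph_genMul hol ht x)
  rw [← hT.apply_add hs ht.le] at h
  exact (hT.opGraph_genMul hol (by linarith) x).unique h

lemma opGraph_genSqMul (hT : IsC0Semigroup T) (hol : IsSectoriallyBoundedHolomorphic T) {t : ℝ}
    (ht : 0 < t) (x : X) : OpGraph T (genMul T t x) (genSqMul T t x) := by
  have h := hT.opGraph_genMul hol (half_pos ht) (genMul T (t / 2) x)
  rwa [← hT.genMul_add_apply hol (half_pos ht).le (half_pos ht), add_halves] at h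

lemma hasDerivAt_genMul (hT : IsC0Semigroup T) (hol : IsSectoriallyBoundedHolomorphic T) {t : ℝ}
    (ht : 0 < t) : HasDerivAt (genMul T) (-genSqMul T t) t := by
  -- Near `t` one has `genMul T u = T (u - t / 2) ∘ genMul T (t / 2)`, so only the semigroup has to
  -- be differentiated.
  have h1 : HasDerivAt (fun u => T (u - t / 2)) (-genMul T (t / 2)) t := by
    have h0 : HasDerivAt T (-genMul T (t / 2)) (t - t / 2) := by
      rw [sub_half]; exact hol.hasDerivAt_genMul (half_pos ht)
    simpa [Function.comp_def] using h0.scomp t ((hasDerivAt_id t).sub_const (t / 2))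
  have h2 : HasDerivAt (fun u => (T (u - t / 2)).comp (genMul T (t / 2)))
      ((-genMul T (t / 2)).comp (genMul T (t / 2))) t := by
    let Φ : (X →L[ℂ] X) →L[ℂ] (X →L[ℂ] X) :=
      (ContinuousLinearMap.compL ℂ X X X).flip (genMul T (t / 2))
    exact (Φ.restrictScalars ℝ).hasFDerivAt.comp_hasDerivAt t h1
  rw [ContinuousLinearMap.neg_comp] at h2
  refine h2.congr_of_eventuallyEq ?_
  filter_upwards [Ioi_mem_nhds (show t / 2 < t by linarith)] with u hu
  ext x
  have hu' : 0 ≤ u - t / 2 := sub_nonneg.2 (le_of_lt hu)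
  rw [ContinuousLinearMap.comp_apply, ← hT.genMul_add_apply hol hu' (half_pos ht), sub_add_cancel]

lemma isPowSemigroup_zero (t : ℝ) : IsPowSemigroup T 0 t (T t) := fun _ => rfl

lemma isPowSemigroup_one (hT : IsC0Semigroup T) (hol : IsSectoriallyBoundedHolomorphic T) {t : ℝ}
    (ht : 0 < t) : IsPowSemigroup T 1 t (genMul T t) :=
  fun x => ⟨_, hT.opGraph_genMul hol ht x, rfl⟩

lemma isPowSemigroup_two (hT : IsC0Semigroup T) (hol : IsSectoriallyBoundedHolomorphic T) {t : ℝ}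
    (ht : 0 < t) : IsPowSemigroup T 2 t (genSqMul T t) :=
  fun x => ⟨_, hT.opGraph_genMul hol ht x, _, hT.opGraph_genSqMul hol ht x, rfl⟩

lemma bddAbove_powNorms_zero (hol : IsSectoriallyBoundedHolomorphic T) :
    BddAbove (powNorms T 0) := by
  obtain ⟨C, hC⟩ := hol.exists_norm_le
  exact bddAbove_powNorms (fun t _ => isPowSemigroup_zero t)
    fun t ht => by simpa using hC t ht.le

lemma bddAbove_powNorms_one (hT : IsC0Semigroup T) (hol : IsSectoriallyBoundedHolomorphic T) :
    BddAbove (powNorms T 1) := by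
  obtain ⟨C, hC⟩ := hol.exists_norm_genMul_le
  exact bddAbove_powNorms (fun t ht => hT.isPowSemigroup_one hol ht)
    fun t ht => by simpa using hC t ht

lemma bddAbove_powNorms_two (hT : IsC0Semigroup T) (hol : IsSectoriallyBoundedHolomorphic T) :
    BddAbove (powNorms T 2) := by
  obtain ⟨C, hC⟩ := hol.exists_norm_genMul_le
  refine bddAbove_powNorms (fun t ht => hT.isPowSemigroup_two hol ht) (C := 4 * C ^ 2)
    fun t ht => ?_
  have h1 := hC (t / 2) (half_pos ht)
  have h2 : ‖genSqMul T t‖ ≤ ‖genMul T (t / 2)‖ * ‖genMul T (t / 2)‖ :=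
    ContinuousLinearMap.opNorm_comp_le _ _
  have h3 : (t / 2 * ‖genMul T (t / 2)‖) ^ 2 ≤ C ^ 2 := by gcongr
  calc t ^ 2 * ‖genSqMul T t‖ ≤ t ^ 2 * (‖genMul T (t / 2)‖ * ‖genMul T (t / 2)‖) := by gcongr
    _ = 4 * (t / 2 * ‖genMul T (t / 2)‖) ^ 2 := by ring
    _ ≤ 4 * C ^ 2 := by gcongr

/-- `supM` only sees `t > 0`; the bound reaches `T 0` by strong continuity. -/
lemma norm_le_supM (hT : IsC0Semigroup T) (hol : IsSectoriallyBoundedHolomorphic T) {t : ℝ}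
    (ht : 0 ≤ t) : ‖T t‖ ≤ supM T 0 := by
  have hpos : ∀ u, 0 < u → ‖T u‖ ≤ supM T 0 := fun u hu => by
    simpa using norm_le_supM_div (bddAbove_powNorms_zero hol) hu (isPowSemigroup_zero u)
  rcases ht.eq_or_lt with rfl | ht
  · refine ContinuousLinearMap.opNorm_le_bound _ ((norm_nonneg _).trans (hpos 1 one_pos))
      fun x => ?_
    rw [hT.map_zero, ContinuousLinearMap.id_apply]
    refine le_of_tendsto (hT.tendsto_zero x).norm ?_
    filter_upwards [self_mem_nhdsWithin] with u hu
    exact (T u).le_of_opNorm_le (hpos u hu) x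
  · exact hpos t ht

lemma one_le_supM (hT : IsC0Semigroup T) (hol : IsSectoriallyBoundedHolomorphic T)
    [Nontrivial X] : 1 ≤ supM T 0 := by
  have h := hT.norm_le_supM hol le_rfl
  rwa [hT.map_zero, ContinuousLinearMap.norm_id] at h

lemma norm_genMul_le (hT : IsC0Semigroup T) (hol : IsSectoriallyBoundedHolomorphic T) {t : ℝ}
    (ht : 0 < t) : ‖genMul T t‖ ≤ supM T 1 / t := by
  simpa using norm_le_supM_div (hT.bddAbove_powNorms_one hol) ht (hT.isPowSemigroup_one hol ht)

lemma norm_genSqMul_le (hT : IsC0Semigroup T) (hol : IsSectoriallyBoundedHolomorphic T) {t : ℝ}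
    (ht : 0 < t) : ‖genSqMul T t‖ ≤ supM T 2 / t ^ 2 :=
  norm_le_supM_div (hT.bddAbove_powNorms_two hol) ht (hT.isPowSemigroup_two hol ht)

lemma supM_nonneg (k : ℕ) : 0 ≤ supM T k := by
  refine Real.sSup_nonneg ?_
  rintro _ ⟨t, -, B, -, rfl⟩
  exact norm_nonneg _

end IsC0Semigroup

end Semigroup

/-! ### Remainders with a bounded second derivative, and the endpoint `0`. -/

section TaylorBounds

variable {E : Type*} [NormedAddCommGroup E] [NormedSpace ℝ E] {W W₁ W₂ : ℝ → E}

/-- Second-order Taylor bound for a bounded second derivative. -/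
lemma norm_taylor_le_of_norm_le (hW : ∀ u, 0 < u → HasDerivAt W (-W₁ u) u)
    (hW₁ : ∀ u, 0 < u → HasDerivAt W₁ (-W₂ u) u) {m : ℝ}
    (hm : ∀ u, 0 < u → ‖W₂ u‖ ≤ m) {s : ℝ} (hs : 0 < s) :
    ‖W s - W 1 + (s - 1) • W₁ 1‖ ≤ m / 2 * (s - 1) ^ 2 := by
  rcases le_total 1 s with hs1 | hs1
  · exact norm_taylor_le_of_one_le hW hW₁ (fun u hu => hm u (by linarith)) hs1
  have hpos : ∀ v ∈ Icc 0 (1 - s), 0 < 1 - v := fun v hv => by linarith [hv.2]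
  have hB1 : ∀ v : ℝ, HasDerivAt (fun v => m * v) m v := fun v => by
    simpa using (hasDerivAt_id v).const_mul m
  have hB : ∀ v : ℝ, HasDerivAt (fun v => m / 2 * v ^ 2) (m * v) v := fun v => by
    refine ((hasDerivAt_pow 2 v).const_mul (m / 2)).congr_deriv ?_
    push_cast; ring
  have h1 : ∀ v ∈ Icc 0 (1 - s), ‖W₁ (1 - v) - W₁ 1‖ ≤ m * v := by
    refine norm_le_of_hasDerivAt (f' := fun v => W₂ (1 - v)) (fun v hv => ?_)
      (fun v _ => hB1 v) (by simp) (by simp) fun v hv => hm _ (hpos v hv)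
    have := (hW₁ (1 - v) (hpos v hv)).scomp v ((hasDerivAt_id v).const_sub 1)
    simpa using this.sub_const (W₁ 1)
  have h2 := norm_le_of_hasDerivAt (d := 1 - s)
    (fun v hv => hasDerivAt_taylor_left hW (v := v) (hpos v hv))
    (fun v _ => hB v) (by simp) (by simp) h1 (1 - s) ⟨by linarith, le_rfl⟩
  rw [sub_sub_cancel] at h2
  rwa [← neg_sub 1 s, neg_smul, ← sub_eq_add_neg, neg_sq]

/-- The endpoint cannot be dropped, since the representing measure may charge `0`. -/
lemma norm_taylor_le_of_pos (hW : ContinuousOn W (Ici 0)) {w : E} {Q : ℝ}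
    (h : ∀ s, 0 < s → ‖W s - W 1 + (s - 1) • w‖ ≤ Q * (s - 1) ^ 2) {s : ℝ} (hs : 0 ≤ s) :
    ‖W s - W 1 + (s - 1) • w‖ ≤ Q * (s - 1) ^ 2 := by
  rcases hs.eq_or_lt with rfl | hs
  · have h0 : Tendsto W (𝓝[>] 0) (𝓝 (W 0)) :=
      (hW 0 self_mem_Ici).mono_left (nhdsWithin_mono _ Ioi_subset_Ici_self)
    have h1 : Tendsto (fun s : ℝ => (s - 1) • w) (𝓝[>] 0) (𝓝 (((0 : ℝ) - 1) • w)) :=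
      Continuous.continuousWithinAt (by fun_prop)
    have h2 : Tendsto (fun s : ℝ => Q * (s - 1) ^ 2) (𝓝[>] 0) (𝓝 (Q * (0 - 1) ^ 2)) :=
      Continuous.continuousWithinAt (by fun_prop)
    refine le_of_tendsto_of_tendsto ((h0.sub_const _).add h1).norm h2 ?_
    filter_upwards [self_mem_nhdsWithin] with u hu using h u hu
  · exact h s hs

end TaylorBounds

/-! ### From Taylor remainders to the approximation error. -/

section HillePhillips

variable {X : Type*} [NormedAddCommGroup X] [NormedSpace ℂ X] {T : ℝ → X →L[ℂ] X}

/-- A bounded strongly continuous family has a strong integral against a finite measure. -/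
lemma exists_isHillePhillips {g : ℝ → ℝ} {ν : Measure ℝ} (hν : IsLaplaceTransformOf g ν)
    (hcont : ∀ x, ContinuousOn (fun s => T s x) (Ici 0)) {C : ℝ} (hC : ∀ s, 0 ≤ s → ‖T s‖ ≤ C) :
    ∃ B : X →L[ℂ] X, IsHillePhillips T g B := by
  have := hν.1
  -- Continuity, hence measurability, is only known on `[0, ∞)`, which carries `ν`.
  have hres : ν.restrict (Ici 0) = ν := Measure.restrict_eq_self_of_ae_mem hν.ae_nonneg
  have hint : ∀ x, Integrable (fun s => T s x) ν := fun x => by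
    refine Integrable.of_bound (C := C * ‖x‖) ?_
      (hν.ae_nonneg.mono fun s hs => (T s).le_of_opNorm_le (hC s hs) x)
    rw [← hres]
    exact (hcont x).aestronglyMeasurable measurableSet_Ici
  let L : X →ₗ[ℂ] X :=
    { toFun := fun x => ∫ s, T s x ∂ν
      map_add' := fun x y => by
        simp only [map_add]; exact integral_add (hint x) (hint y)
      map_smul' := fun a x => by
        simp only [map_smul, RingHom.id_apply]; exact integral_smul a _ }
  refine ⟨L.mkContinuous (C * ν.real univ) fun x => ?_, ν, hν, fun x => ⟨hint x, rfl⟩⟩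
  have h := norm_integral_le_of_norm_le_const (μ := ν) (f := fun s => T s x) (C := C * ‖x‖)
    (hν.ae_nonneg.mono fun s hs => (T s).le_of_opNorm_le (hC s hs) x)
  calc ‖L x‖ ≤ C * ‖x‖ * ν.real univ := h
    _ = C * ν.real univ * ‖x‖ := by ring

/-- The approximant is a strong integral against a measure with Laplace transform `g ^ n`. -/
lemma IsNormalizedCM.exists_approximant_eq (hol : IsSectoriallyBoundedHolomorphic T) {g : ℝ → ℝ}
    {c : ℝ} (hg : IsNormalizedCM g c) (n : ℕ) {t : ℝ} (ht : 0 < t) :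
    ∃ ν : Measure ℝ, IsLaplaceTransformOf (fun z => g z ^ n) ν ∧ ∀ x,
      Integrable (fun s : ℝ => T (t / n * s) x) ν ∧
        approximant T g n t x = ∫ s, T (t / n * s) x ∂ν := by
  obtain ⟨μ, hμ⟩ := hg.1.exists_isLaplaceTransformOf hg.2.1
  obtain ⟨ν, hν⟩ := hμ.exists_pow n
  obtain ⟨C, hC⟩ := hol.exists_norm_le
  have hnn : ∀ s : ℝ, 0 ≤ s → 0 ≤ t / n * s := fun s hs => by positivity
  have hex : ∃ B : X →L[ℂ] X, IsHillePhillips (fun s => T (t / n * s)) (fun z => g z ^ n) B :=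
    exists_isHillePhillips hν
      (fun x => (hol.continuousOn x).comp (by fun_prop) fun s hs => hnn s hs)
      fun s hs => hC _ (hnn s hs)
  have hB := hex.choose_spec
  -- Bernstein's theorem serves only to show that the calculus is defined. The measure behind the
  -- chosen operator may be another one, but its moments are computed from `g ^ n` alone, so
  -- uniqueness is not needed.
  rw [approximant, hillePhillips, dif_pos hex]
  exact hB

/-- A quadratic bound for the Taylor remainder gives a bound for the approximation error. -/
lemma IsNormalizedCM.norm_semigroup_error_le [CompleteSpace X] (hT : IsC0Semigroup T)
    (hol : IsSectoriallyBoundedHolomorphic T) {g : ℝ → ℝ} {c : ℝ} (hg : IsNormalizedCM g c)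
    {n : ℕ} (hn : 0 < n) {t : ℝ} (ht : 0 < t) {r : ℝ} (hr : 0 ≤ r) {x w : X} {Q : ℝ}
    (hQ : ∀ u, 0 ≤ u → ‖T (t * u + r) x - T (t * 1 + r) x + (u - 1) • w‖ ≤ Q * (u - 1) ^ 2) :
    ‖T r (approximant T g n t x - T t x)‖ ≤ Q * ((c - 1) / n) := by
  obtain ⟨ν, hν, hx⟩ := hg.exists_approximant_eq hol n ht (T := T)
  obtain ⟨hi, heq⟩ := hx x
  obtain ⟨hm0, hvi, hv⟩ := hg.variance_pow hn hν
  obtain ⟨hP, ⟨hi1, -⟩, -⟩ := hg.moments_pow hν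
  have hn' : (n : ℝ) ≠ 0 := by positivity
  have hTr : Integrable (fun s : ℝ => T r (T (t / n * s) x)) ν := (T r).integrable_comp hi
  have hw : Integrable (fun s : ℝ => (s / n - 1) • w) ν :=
    ((hi1.div_const _).sub (integrable_const _)).smul_const w
  -- The linear term may be inserted because `s / n - 1` has mean zero.
  have h1 : T r (approximant T g n t x - T t x) =
      ∫ s, (T r (T (t / n * s) x) - T r (T t x) + (s / n - 1) • w) ∂ν := by
    rw [integral_add (f := fun s : ℝ => T r (T (t / n * s) x) - T r (T t x))
        (hTr.sub (integrable_const _)) hw, integral_smul_const, hm0, zero_smul,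
      add_zero, integral_sub hTr (integrable_const _), map_sub, heq,
      ContinuousLinearMap.integral_comp_comm _ hi]
    simp
  rw [h1, ← hv, ← integral_const_mul]
  refine norm_integral_le_of_norm_le (hvi.const_mul Q) (hν.ae_nonneg.mono fun s hs => ?_)
  have hsn : 0 ≤ s / n := by positivity
  have h2 := hQ (s / n) hsn
  rwa [mul_one, add_comm t r, hT.apply_add hr ht.le, add_comm _ r,
    hT.apply_add hr (by positivity), show t * (s / n) = t / n * s by ring] at h2

lemma IsNormalizedCM.variance_nonneg {g : ℝ → ℝ} {c : ℝ} (hg : IsNormalizedCM g c) {n : ℕ}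
    (hn : 0 < n) : 0 ≤ (c - 1) / n := by
  obtain ⟨μ, hμ⟩ := hg.1.exists_isLaplaceTransformOf hg.2.1
  obtain ⟨ν, hν⟩ := hμ.exists_pow n
  rw [← (hg.variance_pow hn hν).2.2]
  exact integral_nonneg fun s => sq_nonneg _

namespace IsC0Semigroup

lemma hasDerivAt_comp_affine {F F' : ℝ → X →L[ℂ] X} {t r : ℝ} (ht : 0 < t) (hr : 0 ≤ r)
    (h : ∀ u, 0 < u → HasDerivAt F (-F' u) u) (x : X) :
    ∀ u, 0 < u → HasDerivAt (fun u => F (t * u + r) x) (-(t • F' (t * u + r) x)) u := by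
  intro u hu
  have h1 := hasDerivAt_apply (h (t * u + r) (by positivity)) x
  have h2 := h1.scomp u (((hasDerivAt_id u).const_mul t).add_const r)
  simpa [Function.comp_def] using h2

/-- The shift `r` costs nothing, since `t u + r ≥ t u` only improves the bounds on the derivatives.
-/
lemma norm_taylor_shift_le (hT : IsC0Semigroup T) (hol : IsSectoriallyBoundedHolomorphic T)
    {t r : ℝ} (ht : 0 < t) (hr : 0 ≤ r) (x : X) {u : ℝ} (hu : 0 ≤ u) :
    ‖T (t * u + r) x - T (t * 1 + r) x + (u - 1) • (t • genMul T (t * 1 + r) x)‖ ≤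
      (3 * supM T 0 + 3 * supM T 1 + supM T 2 / 2) * ‖x‖ * (u - 1) ^ 2 := by
  have h := norm_taylor_le (W := fun u => T (t * u + r) x)
    (W₁ := fun u => t • genMul T (t * u + r) x)
    (W₂ := fun u => t • t • genSqMul T (t * u + r) x) (m₀ := supM T 0 * ‖x‖)
    (m₁ := supM T 1 * ‖x‖) (m₂ := supM T 2 * ‖x‖)
    (hasDerivAt_comp_affine ht hr (fun u hu => hol.hasDerivAt_genMul hu) x)
    (fun u hu => by
      simpa using (hasDerivAt_comp_affine ht hr
        (fun u hu => hT.hasDerivAt_genMul hol hu) x u hu).fun_const_smul t)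
    (fun u hu => (T _).le_of_opNorm_le (hT.norm_le_supM hol (by positivity)) x)
    (fun u hu => ?_) (fun u hu => ?_) hu
  · refine h.trans_eq ?_
    ring
  · have hpos : 0 < t * u := by positivity
    have h1 := (genMul T (t * u + r)).le_of_opNorm_le
      (hT.norm_genMul_le hol (show 0 < t * u + r by positivity)) x
    have h2 : supM T 1 / (t * u + r) ≤ supM T 1 / (t * u) :=
      div_le_div_of_nonneg_left (supM_nonneg 1) hpos (by linarith)
    rw [norm_smul, Real.norm_of_nonneg ht.le]
    calc t * ‖genMul T (t * u + r) x‖ ≤ t * (supM T 1 / (t * u) * ‖x‖) := by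
          gcongr
          exact h1.trans (by gcongr)
      _ = supM T 1 * ‖x‖ / u := by field_simp
  · have hpos : 0 < t * u := by positivity
    have h1 := (genSqMul T (t * u + r)).le_of_opNorm_le
      (hT.norm_genSqMul_le hol (show 0 < t * u + r by positivity)) x
    have h2 : supM T 2 / (t * u + r) ^ 2 ≤ supM T 2 / (t * u) ^ 2 :=
      div_le_div_of_nonneg_left (supM_nonneg 2) (by positivity) (by gcongr; linarith)
    rw [norm_smul, norm_smul, Real.norm_of_nonneg ht.le]
    calc t * (t * ‖genSqMul T (t * u + r) x‖) ≤ t * (t * (supM T 2 / (t * u) ^ 2 * ‖x‖)) := by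
          gcongr
          exact h1.trans (by gcongr)
      _ = supM T 2 * ‖x‖ / u ^ 2 := by field_simp

/-- For `r > 0` the second derivative is bounded by `M₂ t² / r²` uniformly in `u`, which yields the
decay in `r` needed for fractional powers. -/
lemma norm_taylor_shift_le_div_sq (hT : IsC0Semigroup T) (hol : IsSectoriallyBoundedHolomorphic T)
    {t r : ℝ} (ht : 0 < t) (hr : 0 < r) (x : X) {u : ℝ} (hu : 0 ≤ u) :
    ‖T (t * u + r) x - T (t * 1 + r) x + (u - 1) • (t • genMul T (t * 1 + r) x)‖ ≤
      supM T 2 / 2 * (t ^ 2 / r ^ 2) * ‖x‖ * (u - 1) ^ 2 := by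
  refine norm_taylor_le_of_pos (W := fun u => T (t * u + r) x)
    ((hol.continuousOn x).comp (by fun_prop) fun u hu => ?_) (fun u hu => ?_) hu
  · have : (0 : ℝ) ≤ u := hu
    change 0 ≤ t * u + r
    positivity
  · have h := norm_taylor_le_of_norm_le (W := fun u => T (t * u + r) x)
      (W₁ := fun u => t • genMul T (t * u + r) x)
      (W₂ := fun u => t • t • genSqMul T (t * u + r) x) (m := supM T 2 * (t ^ 2 / r ^ 2) * ‖x‖)
      (hasDerivAt_comp_affine ht hr.le (fun u hu => hol.hasDerivAt_genMul hu) x)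
      (fun u hu => by
        simpa using (hasDerivAt_comp_affine ht hr.le
          (fun u hu => hT.hasDerivAt_genMul hol hu) x u hu).fun_const_smul t)
      (fun u hu => ?_) hu
    · refine h.trans_eq ?_
      ring
    · have hpos : 0 < t * u := by positivity
      have h1 := (genSqMul T (t * u + r)).le_of_opNorm_le
        (hT.norm_genSqMul_le hol (show 0 < t * u + r by positivity)) x
      have h2 : supM T 2 / (t * u + r) ^ 2 ≤ supM T 2 / r ^ 2 :=
        div_le_div_of_nonneg_left (supM_nonneg 2) (by positivity) (by gcongr; linarith)
      rw [norm_smul, norm_smul, Real.norm_of_nonneg ht.le]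
      calc t * (t * ‖genSqMul T (t * u + r) x‖) ≤ t * (t * (supM T 2 / r ^ 2 * ‖x‖)) := by
            gcongr
            exact h1.trans (by gcongr)
        _ = supM T 2 * (t ^ 2 / r ^ 2) * ‖x‖ := by ring

/-- Since `A² T u x = A T u y`, one power of the singularity is gained. The summand `0` matches the
shifted form of the error lemma. -/
lemma norm_taylor_le_of_opGraph (hT : IsC0Semigroup T) (hol : IsSectoriallyBoundedHolomorphic T)
    {t : ℝ} (ht : 0 < t) {x y : X} (hxy : OpGraph T x y) {u : ℝ} (hu : 0 ≤ u) :
    ‖T (t * u + 0) x - T (t * 1 + 0) x + (u - 1) • (t • T (t * 1 + 0) y)‖ ≤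
      supM T 1 * t * ‖y‖ * (u - 1) ^ 2 := by
  refine norm_taylor_le_of_pos (W := fun u => T (t * u + 0) x)
    ((hol.continuousOn x).comp (by fun_prop) fun u hu => ?_) (fun u hu => ?_) hu
  · have : (0 : ℝ) ≤ u := hu
    change 0 ≤ t * u + 0
    positivity
  · refine norm_taylor_le_of_norm_le_div (W := fun u => T (t * u + 0) x)
      (W₁ := fun u => t • T (t * u + 0) y) (W₂ := fun u => t • t • genMul T (t * u + 0) y)
      (fun u hu => ?_) (fun u hu => ?_) (fun u hu => ?_) hu
    · rw [← hT.genMul_apply_of_opGraph hol (by positivity) hxy]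
      exact hasDerivAt_comp_affine ht le_rfl (fun u hu => hol.hasDerivAt_genMul hu) x u hu
    · simpa using (hasDerivAt_comp_affine ht le_rfl
        (fun u hu => hol.hasDerivAt_genMul hu) y u hu).fun_const_smul t
    · have h1 := (genMul T (t * u + 0)).le_of_opNorm_le
        (hT.norm_genMul_le hol (show 0 < t * u + 0 by positivity)) y
      rw [norm_smul, norm_smul, Real.norm_of_nonneg ht.le]
      calc t * (t * ‖genMul T (t * u + 0) y‖) ≤ t * (t * (supM T 1 / (t * u + 0) * ‖y‖)) := by
            gcongr
        _ = supM T 1 * t * ‖y‖ / u := by rw [add_zero]; field_simp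

end IsC0Semigroup

end HillePhillips

/-! ### Beta integrals and the constant in the fractional bound. -/

section RealIntegrals

/-- The integrand of Euler's beta integral on `(0, q)`, extended by zero. -/
noncomputable def betaKernel (α r q : ℝ) : ℝ :=
  if r < q then r ^ (α - 1) * (q - r) ^ (-α) else 0

lemma measurable_betaKernel (α : ℝ) : Measurable fun p : ℝ × ℝ => betaKernel α p.1 p.2 :=
  Measurable.ite (measurableSet_lt measurable_fst measurable_snd) (by fun_prop) measurable_const

lemma betaKernel_nonneg {α r q : ℝ} (hr : 0 < r) : 0 ≤ betaKernel α r q := by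
  rw [betaKernel]
  split_ifs with h
  · exact mul_nonneg (Real.rpow_nonneg hr.le _) (Real.rpow_nonneg (by linarith) _)
  · exact le_rfl

lemma integral_betaKernel_one {α : ℝ} (h0 : 0 < α) (h1 : α < 1) :
    IntegrableOn (fun r => betaKernel α r 1) (Ioi 0) ∧
      ∫ r in Ioi 0, betaKernel α r 1 = Real.Gamma α * Real.Gamma (1 - α) := by
  have hb : ProbabilityTheory.beta α (1 - α) = Real.Gamma α * Real.Gamma (1 - α) := by
    simp [ProbabilityTheory.beta]
  have hbpos : 0 < ProbabilityTheory.beta α (1 - α) :=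
    ProbabilityTheory.beta_pos h0 (by linarith)
  have hl := ProbabilityTheory.lintegral_betaPDF_eq_one h0 (sub_pos.2 h1)
  have heq : ∀ r ∈ Ioi (0 : ℝ), betaKernel α r 1 = ProbabilityTheory.beta α (1 - α) *
      ProbabilityTheory.betaPDFReal α (1 - α) r := by
    intro r hr
    simp only [betaKernel, ProbabilityTheory.betaPDFReal]
    have hr' : 0 < r := hr
    by_cases hr1 : r < 1
    · rw [if_pos hr1, if_pos ⟨hr', hr1⟩, show 1 - α - 1 = -α by ring]
      field_simp
    · rw [if_neg hr1, if_neg fun h => hr1 h.2, mul_zero]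
  have hnn : ∀ r, 0 ≤ ProbabilityTheory.betaPDFReal α (1 - α) r := by
    intro r
    by_cases hr : 0 < r ∧ r < 1
    · exact (ProbabilityTheory.betaPDFReal_pos hr.1 hr.2 h0 (by linarith)).le
    · rw [ProbabilityTheory.betaPDFReal, if_neg hr]
  have hpdf_int : Integrable (ProbabilityTheory.betaPDFReal α (1 - α)) := by
    refine ⟨(ProbabilityTheory.measurable_betaPDFReal _ _).aestronglyMeasurable, ?_⟩
    rw [hasFiniteIntegral_iff_ofReal (ae_of_all _ hnn)]
    exact lt_of_eq_of_lt hl ENNReal.one_lt_top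
  have hpdf : ∫ r, ProbabilityTheory.betaPDFReal α (1 - α) r = 1 := by
    rw [integral_eq_lintegral_of_nonneg_ae (ae_of_all _ hnn) hpdf_int.1]
    exact (ENNReal.toReal_eq_one_iff _).2 hl
  constructor
  · exact ((hpdf_int.const_mul _).integrableOn).congr_fun (fun r hr => (heq r hr).symm)
      measurableSet_Ioi
  · rw [setIntegral_congr_fun measurableSet_Ioi heq, integral_const_mul,
      setIntegral_eq_integral_of_forall_compl_eq_zero, hpdf, mul_one, hb]
    intro r hr
    rw [ProbabilityTheory.betaPDFReal, if_neg fun h => hr h.1]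

lemma betaKernel_mul {α r q : ℝ} (hr : 0 < r) (hq : 0 < q) :
    betaKernel α (q * r) q = q⁻¹ * betaKernel α r 1 := by
  simp only [betaKernel]
  by_cases h : r < 1
  · rw [if_pos h, if_pos (by nlinarith), show q - q * r = q * (1 - r) by ring,
      Real.mul_rpow hq.le hr.le, Real.mul_rpow hq.le (by linarith)]
    have : q ^ (α - 1) * q ^ (-α) = q⁻¹ := by
      rw [← Real.rpow_add hq, ← Real.rpow_neg_one]; ring_nf
    rw [← this]; ring
  · rw [if_neg h, if_neg (by nlinarith), mul_zero]

lemma integral_betaKernel {α q : ℝ} (h0 : 0 < α) (h1 : α < 1) (hq : 0 < q) :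
    IntegrableOn (fun r => betaKernel α r q) (Ioi 0) ∧
      ∫ r in Ioi 0, betaKernel α r q = Real.Gamma α * Real.Gamma (1 - α) := by
  obtain ⟨hi, hI⟩ := integral_betaKernel_one h0 h1
  have hcongr : ∀ r ∈ Ioi (0 : ℝ), q⁻¹ * betaKernel α r 1 = betaKernel α (q * r) q :=
    fun r hr => (betaKernel_mul hr hq).symm
  constructor
  · have h2 : IntegrableOn (fun r => betaKernel α (q * r) q) (Ioi 0) :=
      IntegrableOn.congr_fun (hi.const_mul q⁻¹) hcongr measurableSet_Ioi
    simpa using (integrableOn_Ioi_comp_mul_left_iff (fun r => betaKernel α r q) 0 hq).1 h2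
  · have h2 := integral_comp_mul_left_Ioi (fun r => betaKernel α r q) 0 hq
    rw [← setIntegral_congr_fun measurableSet_Ioi hcongr, integral_const_mul, mul_zero, hI,
      smul_eq_mul] at h2
    exact (mul_left_cancel₀ (inv_ne_zero hq.ne') h2).symm

/-- Composition of the fractional integrals of orders `α` and `1 - α`. -/
lemma integral_rpow_smul_integral_rpow_smul {E : Type*} [NormedAddCommGroup E] [NormedSpace ℝ E]
    [CompleteSpace E] {α : ℝ} (h0 : 0 < α) (h1 : α < 1) {w : ℝ → E} (hw : IntegrableOn w (Ioi 0)) :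
    ∫ r in Ioi (0 : ℝ), r ^ (α - 1) • ∫ s in Ioi (0 : ℝ), s ^ (-α) • w (r + s) =
      (Real.Gamma α * Real.Gamma (1 - α)) • ∫ q in Ioi (0 : ℝ), w q := by
  have hmeas : AEStronglyMeasurable (fun p : ℝ × ℝ => betaKernel α p.1 p.2 • w p.2)
      ((volume.restrict (Ioi 0)).prod (volume.restrict (Ioi 0))) :=
    (measurable_betaKernel α).aestronglyMeasurable.smul hw.1.comp_snd
  have hint : Integrable (fun p : ℝ × ℝ => betaKernel α p.1 p.2 • w p.2)
      ((volume.restrict (Ioi 0)).prod (volume.restrict (Ioi 0))) := by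
    rw [integrable_prod_iff' hmeas]
    constructor
    · refine (ae_restrict_mem measurableSet_Ioi).mono fun q hq => ?_
      exact (integral_betaKernel h0 h1 hq).1.smul_const (w q)
    · refine (hw.norm.const_mul (Real.Gamma α * Real.Gamma (1 - α))).congr
        ((ae_restrict_mem measurableSet_Ioi).mono fun q hq => ?_)
      beta_reduce
      rw [← (integral_betaKernel h0 h1 hq).2, ← integral_mul_const]
      refine setIntegral_congr_fun measurableSet_Ioi fun r hr => ?_
      simp only [norm_smul, Real.norm_of_nonneg (betaKernel_nonneg hr)]
  have hinner : ∀ r ∈ Ioi (0 : ℝ), r ^ (α - 1) • ∫ s in Ioi (0 : ℝ), s ^ (-α) • w (r + s) =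
      ∫ q in Ioi (0 : ℝ), betaKernel α r q • w q := by
    intro r hr
    have hr' : 0 < r := hr
    have hsub : ∫ q in Ioi (0 : ℝ), betaKernel α r q • w q =
        ∫ q in Ioi r, r ^ (α - 1) • ((q - r) ^ (-α) • w q) := by
      have : ∀ q, betaKernel α r q • w q =
          (Ioi r).indicator (fun q => r ^ (α - 1) • ((q - r) ^ (-α) • w q)) q := by
        intro q
        by_cases hq : r < q
        · rw [indicator_of_mem (mem_Ioi.2 hq), betaKernel, if_pos hq, mul_smul]
        · rw [indicator_of_notMem (notMem_Ioi.2 (not_lt.1 hq)), betaKernel, if_neg hq, zero_smul]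
      simp only [this]
      rw [setIntegral_indicator measurableSet_Ioi, Ioi_inter_Ioi, max_eq_right hr'.le]
    rw [hsub, integral_smul]
    congr 1
    have h2 := (measurePreserving_add_left volume r).setIntegral_preimage_emb
      (measurableEmbedding_addLeft r) (fun q => (q - r) ^ (-α) • w q) (Ioi r)
    rw [← h2]
    simp
  -- After the swap the integral in `r` is a beta integral, the same for every `q`.
  rw [setIntegral_congr_fun measurableSet_Ioi hinner, integral_integral_swap hint,
    ← integral_smul]
  refine setIntegral_congr_fun measurableSet_Ioi fun q hq => ?_
  rw [integral_smul_const, (integral_betaKernel h0 h1 hq).2]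

lemma integral_rpow_mul_min {α t : ℝ} (h0 : 0 < α) (h2 : α < 2) (ht : 0 < t) :
    IntegrableOn (fun r : ℝ => r ^ (α - 1) * min 1 (t ^ 2 / r ^ 2)) (Ioi 0) ∧
      ∫ r in Ioi (0 : ℝ), r ^ (α - 1) * min 1 (t ^ 2 / r ^ 2) =
        t ^ α * (1 / α + 1 / (2 - α)) := by
  have heq1 : ∀ r ∈ Ioc 0 t, r ^ (α - 1) = r ^ (α - 1) * min 1 (t ^ 2 / r ^ 2) := by
    intro r hr
    rw [min_eq_left, mul_one]
    rw [one_le_div (by have := hr.1; positivity)]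
    exact pow_le_pow_left₀ hr.1.le hr.2 2
  have heq2 : ∀ r ∈ Ioi t, t ^ 2 * r ^ (α - 3) = r ^ (α - 1) * min 1 (t ^ 2 / r ^ 2) := by
    intro r hr
    have hr0 : 0 < r := ht.trans hr
    rw [min_eq_right, show α - 3 = α - 1 - (2 : ℕ) by push_cast; ring, Real.rpow_sub hr0,
      Real.rpow_natCast]
    · ring
    · rw [div_le_one (by positivity)]
      exact pow_le_pow_left₀ ht.le (le_of_lt hr) 2
  have hi1 : IntegrableOn (fun r : ℝ => r ^ (α - 1) * min 1 (t ^ 2 / r ^ 2)) (Ioc 0 t) := by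
    refine IntegrableOn.congr_fun ?_ heq1 measurableSet_Ioc
    exact (intervalIntegrable_iff_integrableOn_Ioc_of_le ht.le).1
      (intervalIntegral.intervalIntegrable_rpow' (by linarith))
  have hi2 : IntegrableOn (fun r : ℝ => r ^ (α - 1) * min 1 (t ^ 2 / r ^ 2)) (Ioi t) := by
    refine IntegrableOn.congr_fun ?_ heq2 measurableSet_Ioi
    exact (integrableOn_Ioi_rpow_of_lt (by linarith) ht).const_mul _
  rw [← Ioc_union_Ioi_eq_Ioi ht.le]
  refine ⟨hi1.union hi2, ?_⟩
  rw [setIntegral_union Ioc_disjoint_Ioi_same measurableSet_Ioi hi1 hi2,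
    ← setIntegral_congr_fun measurableSet_Ioc heq1,
    ← setIntegral_congr_fun measurableSet_Ioi heq2, integral_const_mul,
    integral_Ioi_rpow_of_lt (by linarith) ht, ← intervalIntegral.integral_of_le ht.le,
    integral_rpow (Or.inl (by linarith))]
  rw [sub_add_cancel, Real.zero_rpow h0.ne', sub_zero, show α - 3 + 1 = α - (2 : ℕ) by
    push_cast; ring, Real.rpow_sub ht, Real.rpow_natCast]
  have h3 : (2 : ℝ) - α ≠ 0 := by linarith
  have h4 : α - ((2 : ℕ) : ℝ) ≠ 0 := by push_cast; linarith
  have h5 : α - ((2 : ℕ) : ℝ) = -(2 - α) := by push_cast; ring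
  rw [h5]
  field_simp

/-- Log-convexity of `Γ` between `1 + α` and `3`, evaluated at `2` where `Γ = 1`, gives `1 ≤ Γ(1 +
α) 2 ^ (1 - α)`; Bernoulli's inequality finishes. -/
lemma one_le_two_sub_mul_Gamma {α : ℝ} (h0 : 0 < α) (h1 : α < 1) :
    1 ≤ (2 - α) * Real.Gamma (1 + α) := by
  have h2 : 0 < 2 - α := by linarith
  have h3 : 0 < 1 - α := by linarith
  have hconv := Real.Gamma_mul_add_mul_le_rpow_Gamma_mul_rpow_Gamma (s := 1 + α) (t := 3)
    (a := 1 / (2 - α)) (b := (1 - α) / (2 - α)) (by linarith) (by norm_num) (by positivity)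
    (by positivity) (by field_simp; ring)
  have hG3 : Real.Gamma 3 = 2 := by
    rw [show (3 : ℝ) = 2 + 1 by norm_num, Real.Gamma_add_one two_ne_zero, Real.Gamma_two, mul_one]
  rw [show 1 / (2 - α) * (1 + α) + (1 - α) / (2 - α) * 3 = 2 by field_simp; ring,
    Real.Gamma_two, hG3] at hconv
  have hG : 0 < Real.Gamma (1 + α) := Real.Gamma_pos_of_pos (by linarith)
  have h4 : 1 ≤ Real.Gamma (1 + α) * 2 ^ (1 - α) := by
    have h5 := Real.one_le_rpow hconv h2.le
    rwa [Real.mul_rpow (by positivity) (by positivity), ← Real.rpow_mul hG.le,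
      ← Real.rpow_mul (by norm_num), one_div_mul_cancel h2.ne', div_mul_cancel₀ _ h2.ne',
      Real.rpow_one] at h5
  have h6 : (2 : ℝ) ^ (1 - α) ≤ 2 - α := by
    have h7 := rpow_one_add_le_one_add_mul_self (s := 1) (by norm_num) h3.le (by linarith)
    norm_num at h7
    linarith
  nlinarith

end RealIntegrals

/-! ### Fractional powers as integrals of the semigroup. -/

section Fractional

variable {X : Type*} [NormedAddCommGroup X] [NormedSpace ℂ X] {T : ℝ → X →L[ℂ] X}

lemma IsSectoriallyBoundedHolomorphic.aestronglyMeasurable (hol : IsSectoriallyBoundedHolomorphic T)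
    (x : X) : AEStronglyMeasurable (fun s => T s x) (volume.restrict (Ioi 0)) :=
  ((hol.continuousOn x).mono Ioi_subset_Ici_self).aestronglyMeasurable measurableSet_Ioi

/-- The resolvent is the Laplace transform of the semigroup. -/
lemma IsC0Semigroup.eq_integral_of_opGraph [CompleteSpace X] (hT : IsC0Semigroup T)
    (hol : IsSectoriallyBoundedHolomorphic T) {u v : X} {r : ℝ} (hr : 0 < r)
    (h : OpGraph T u (v - r • u)) : u = ∫ s in Ioi (0 : ℝ), Real.exp (-(s * r)) • T s v := by
  have hcont : ContinuousWithinAt (fun s : ℝ => Real.exp (-(s * r)) • T s u) (Ici 0) 0 :=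
    ((by fun_prop : Continuous fun s : ℝ => Real.exp (-(s * r))).continuousWithinAt).smul
      (hol.continuousOn u 0 self_mem_Ici)
  have hexp : IntegrableOn (fun s : ℝ => Real.exp (-(s * r))) (Ioi 0) := by
    refine (integrableOn_exp_mul_Ioi (neg_lt_zero.2 hr) 0).congr_fun (fun s _ => ?_)
      measurableSet_Ioi
    beta_reduce
    rw [neg_mul, mul_comm r s]
  -- As `A u + r u = v`, the two terms of the product rule combine into one.
  have hderiv : ∀ s ∈ Ioi (0 : ℝ), HasDerivAt (fun s : ℝ => Real.exp (-(s * r)) • T s u)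
      (-(Real.exp (-(s * r)) • T s v)) s := by
    intro s hs
    have h1 := hasDerivAt_apply (hol.hasDerivAt_genMul hs) u
    have h2 : HasDerivAt (fun s : ℝ => Real.exp (-(s * r))) (Real.exp (-(s * r)) * (-r)) s := by
      simpa using (((hasDerivAt_id s).mul_const r).fun_neg).exp
    refine (h2.fun_smul h1).congr_deriv ?_
    rw [neg_apply, hT.genMul_apply_of_opGraph hol hs h, map_sub,
      (T s).map_smul_of_tower, mul_smul]
    module
  have hint : IntegrableOn (fun s : ℝ => -(Real.exp (-(s * r)) • T s v)) (Ioi 0) := by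
    refine Integrable.neg ?_
    refine (hexp.mul_const (supM T 0 * ‖v‖)).mono'
      ((by fun_prop : Continuous fun s : ℝ => Real.exp (-(s * r))).aestronglyMeasurable.smul
        (hol.aestronglyMeasurable v)) ((ae_restrict_mem measurableSet_Ioi).mono fun s hs => ?_)
    rw [norm_smul, Real.norm_of_nonneg (Real.exp_pos _).le]
    gcongr
    exact (T s).le_of_opNorm_le (hT.norm_le_supM hol (le_of_lt hs)) v
  have hlim : Tendsto (fun s : ℝ => Real.exp (-(s * r)) • T s u) atTop (𝓝 0) := by
    have h1 : Tendsto (fun s : ℝ => Real.exp (-(s * r)) * (supM T 0 * ‖u‖)) atTop (𝓝 0) := by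
      have h2 : Tendsto (fun s : ℝ => Real.exp (-(s * r))) atTop (𝓝 0) :=
        Real.tendsto_exp_neg_atTop_nhds_zero.comp (tendsto_id.atTop_mul_const hr)
      simpa using h2.mul_const (supM T 0 * ‖u‖)
    refine squeeze_zero_norm' ?_ h1
    filter_upwards [eventually_ge_atTop 0] with s hs
    rw [norm_smul, Real.norm_of_nonneg (Real.exp_pos _).le]
    gcongr
    exact (T s).le_of_opNorm_le (hT.norm_le_supM hol hs) u
  have key := integral_Ioi_of_hasDerivAt_of_tendsto hcont hderiv hint hlim
  rw [integral_neg, zero_sub, neg_inj] at key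
  rw [key]
  simp [hT.map_zero]

/-- A Bochner integral with nonzero value forces integrability. -/
lemma integrableOn_rpow_mul_exp {α s : ℝ} (h0 : 0 < α) (hs : 0 < s) :
    IntegrableOn (fun r : ℝ => r ^ (α - 1) * Real.exp (-(s * r))) (Ioi 0) := by
  have h := Real.integral_rpow_mul_exp_neg_mul_Ioi h0 hs
  refine Integrable.of_integral_ne_zero ?_
  rw [h]
  have := Real.Gamma_pos_of_pos h0
  positivity

/-- On `dom A` the Balakrishnan operator is a fractional integral of the semigroup. -/
lemma BalakrishnanGraph.eq_integral [CompleteSpace X] (hT : IsC0Semigroup T)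
    (hol : IsSectoriallyBoundedHolomorphic T) {α : ℝ} (h0 : 0 < α) (h1 : α < 1) {x y : X}
    (h : BalakrishnanGraph T α x y) :
    ∃ v, OpGraph T x v ∧ IntegrableOn (fun s : ℝ => s ^ (-α) • T s v) (Ioi 0) ∧
      Real.Gamma (1 - α) • y = ∫ s in Ioi (0 : ℝ), s ^ (-α) • T s v := by
  obtain ⟨v, u, hv, hu, -, rfl⟩ := h
  have hGα : 0 < Real.Gamma α := Real.Gamma_pos_of_pos h0
  have hm : AEStronglyMeasurable (fun s : ℝ => s ^ (-α) • T s v) (volume.restrict (Ioi 0)) :=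
    (by fun_prop : Measurable fun s : ℝ => s ^ (-α)).aestronglyMeasurable.smul
      (hol.aestronglyMeasurable v)
  -- Near `0` the semigroup is bounded and `α < 1`; at infinity `T s v = A T s x` is `O(1 / s)`.
  have hIv : IntegrableOn (fun s : ℝ => s ^ (-α) • T s v) (Ioi 0) := by
    have hi1 : IntegrableOn (fun s : ℝ => s ^ (-α) * (supM T 0 * ‖v‖)) (Ioc 0 1) :=
      ((intervalIntegrable_iff_integrableOn_Ioc_of_le zero_le_one).1
        (intervalIntegral.intervalIntegrable_rpow' (by linarith))).mul_const _
    have hi2 : IntegrableOn (fun s : ℝ => s ^ (-α - 1) * (supM T 1 * ‖x‖)) (Ioi 1) :=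
      (integrableOn_Ioi_rpow_of_lt (by linarith) one_pos).mul_const _
    rw [← Ioc_union_Ioi_eq_Ioi zero_le_one] at hm ⊢
    refine IntegrableOn.union ?_ ?_
    · refine hi1.mono' (hm.mono_measure (Measure.restrict_mono subset_union_left le_rfl))
        ((ae_restrict_mem measurableSet_Ioc).mono fun s hs => ?_)
      have hs0 : 0 < s := hs.1
      rw [norm_smul, Real.norm_of_nonneg (Real.rpow_nonneg hs0.le _)]
      gcongr
      exact (T s).le_of_opNorm_le (hT.norm_le_supM hol hs0.le) v
    · refine hi2.mono' (hm.mono_measure (Measure.restrict_mono subset_union_right le_rfl))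
        ((ae_restrict_mem measurableSet_Ioi).mono fun s hs => ?_)
      have hs0 : 0 < s := one_pos.trans hs
      rw [norm_smul, Real.norm_of_nonneg (Real.rpow_nonneg hs0.le _), Real.rpow_sub_one hs0.ne',
        div_mul_eq_mul_div, mul_div_assoc]
      gcongr
      rw [← hT.genMul_apply_of_opGraph hol hs0 hv]
      refine ((genMul T s).le_of_opNorm_le (hT.norm_genMul_le hol hs0) x).trans_eq ?_
      ring
  refine ⟨v, hv, hIv, ?_⟩
  have hmeas : AEStronglyMeasurable
      (fun p : ℝ × ℝ => (p.1 ^ (α - 1) * Real.exp (-(p.2 * p.1))) • T p.2 v)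
      ((volume.restrict (Ioi 0)).prod (volume.restrict (Ioi 0))) :=
    (by fun_prop : Measurable fun p : ℝ × ℝ =>
      p.1 ^ (α - 1) * Real.exp (-(p.2 * p.1))).aestronglyMeasurable.smul
        (hol.aestronglyMeasurable v).comp_snd
  have hGamma : ∀ s ∈ Ioi (0 : ℝ), ∫ r in Ioi (0 : ℝ), r ^ (α - 1) * Real.exp (-(s * r)) =
      Real.Gamma α * s ^ (-α) := by
    intro s hs
    rw [Real.integral_rpow_mul_exp_neg_mul_Ioi h0 hs, one_div, Real.inv_rpow (le_of_lt hs),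
      Real.rpow_neg (le_of_lt hs), mul_comm]
  have hint : Integrable
      (fun p : ℝ × ℝ => (p.1 ^ (α - 1) * Real.exp (-(p.2 * p.1))) • T p.2 v)
      ((volume.restrict (Ioi 0)).prod (volume.restrict (Ioi 0))) := by
    rw [integrable_prod_iff' hmeas]
    constructor
    · refine (ae_restrict_mem measurableSet_Ioi).mono fun s hs => ?_
      exact (integrableOn_rpow_mul_exp h0 hs).smul_const (T s v)
    · refine (hIv.norm.const_mul (Real.Gamma α)).congr
        ((ae_restrict_mem measurableSet_Ioi).mono fun s hs => ?_)
      have hs0 : 0 < s := hs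
      beta_reduce
      rw [norm_smul, Real.norm_of_nonneg (Real.rpow_nonneg hs0.le _), ← mul_assoc,
        ← hGamma s hs, ← integral_mul_const]
      refine setIntegral_congr_fun measurableSet_Ioi fun r hr => ?_
      rw [norm_smul, Real.norm_of_nonneg
        (mul_nonneg (Real.rpow_nonneg (le_of_lt hr) _) (Real.exp_pos _).le)]
  have hswap : ∫ r in Ioi (0 : ℝ), r ^ (α - 1) • u r =
      Real.Gamma α • ∫ s in Ioi (0 : ℝ), s ^ (-α) • T s v := by
    have hinner : ∀ r ∈ Ioi (0 : ℝ), r ^ (α - 1) • u r =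
        ∫ s in Ioi (0 : ℝ), (r ^ (α - 1) * Real.exp (-(s * r))) • T s v := by
      intro r hr
      simp only [mul_smul]
      rw [integral_smul, ← hT.eq_integral_of_opGraph hol hr (hu r hr)]
    rw [setIntegral_congr_fun measurableSet_Ioi hinner, integral_integral_swap hint,
      ← integral_smul]
    refine setIntegral_congr_fun measurableSet_Ioi fun s hs => ?_
    rw [integral_smul_const, hGamma s hs, mul_smul]
  have hrefl := Real.Gamma_mul_Gamma_one_sub α
  have hsin : 0 < Real.sin (Real.pi * α) :=
    Real.sin_pos_of_pos_of_lt_pi (by positivity) (by nlinarith [Real.pi_pos])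
  rw [hswap, smul_smul, smul_smul]
  -- Euler's reflection formula cancels the normalisation of the Balakrishnan integral.
  have : Real.Gamma (1 - α) * (Real.sin (Real.pi * α) / Real.pi) * Real.Gamma α = 1 := by
    calc _ = (Real.Gamma α * Real.Gamma (1 - α)) * (Real.sin (Real.pi * α) / Real.pi) := by ring
      _ = 1 := by rw [hrefl]; field_simp
  rw [this, one_smul]

end Fractional

/-! ### Error bounds for the approximants. -/

section Approximation

variable {X : Type*} [NormedAddCommGroup X] [NormedSpace ℂ X] {T : ℝ → X →L[ℂ] X}

lemma OpGraph.map_of_commute {D : X →L[ℂ] X} (hD : ∀ s, 0 ≤ s → ∀ x, D (T s x) = T s (D x))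
    {x y : X} (h : OpGraph T x y) : OpGraph T (D x) (D y) := by
  refine ((D.continuous.tendsto y).comp h).congr' ?_
  filter_upwards [self_mem_nhdsWithin] with u hu
  rw [Function.comp_apply, D.map_smul_of_tower, map_sub, hD u (le_of_lt hu)]

lemma IsNormalizedCM.approximant_comm [CompleteSpace X] (hT : IsC0Semigroup T)
    (hol : IsSectoriallyBoundedHolomorphic T) {g : ℝ → ℝ} {c : ℝ} (hg : IsNormalizedCM g c) (n : ℕ)
    {t : ℝ} (ht : 0 < t) {r : ℝ} (hr : 0 ≤ r) (x : X) :
    approximant T g n t (T r x) = T r (approximant T g n t x) := by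
  obtain ⟨ν, hν, hx⟩ := hg.exists_approximant_eq hol n ht (T := T)
  rw [(hx x).2, (hx (T r x)).2, ← ContinuousLinearMap.integral_comp_comm _ (hx x).1]
  refine integral_congr_ae (hν.ae_nonneg.mono fun s hs => ?_)
  exact DFunLike.congr_fun (hT.comm (s := t / n * s) (by positivity) hr) x

/-- If an operator `D` commutes with the semigroup and `T r D` decays like `r ^ (-2)`, then `D` is
bounded with respect to the graph of the Balakrishnan operator. -/
lemma BalakrishnanGraph.norm_apply_le [CompleteSpace X] (hT : IsC0Semigroup T)
    (hol : IsSectoriallyBoundedHolomorphic T) {D : X →L[ℂ] X}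
    (hD : ∀ s, 0 ≤ s → ∀ x, D (T s x) = T s (D x)) {κ t : ℝ} (ht : 0 < t)
    (hκ : ∀ r, 0 < r → ∀ x, ‖T r (D x)‖ ≤ κ * min 1 (t ^ 2 / r ^ 2) * ‖x‖) {α : ℝ} (h0 : 0 < α)
    (h1 : α < 1) {x y : X} (h : BalakrishnanGraph T α x y) :
    ‖D x‖ ≤ 2 * κ * t ^ α * ‖y‖ := by
  obtain ⟨v, hv, hIv, hy⟩ := h.eq_integral hT hol h0 h1
  have hGα : 0 < Real.Gamma α := Real.Gamma_pos_of_pos h0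
  have hGα' : 0 < Real.Gamma (1 - α) := Real.Gamma_pos_of_pos (by linarith)
  have hDv := hv.map_of_commute hD
  have hw : IntegrableOn (fun q => T q (D v)) (Ioi 0) := by
    -- The exponent `1` reduces the power weight to the constant `1`.
    have hb := (integral_rpow_mul_min one_pos one_lt_two ht).1.const_mul (κ * ‖v‖)
    refine hb.mono' (hol.aestronglyMeasurable _)
      ((ae_restrict_mem measurableSet_Ioi).mono fun q hq => (hκ q hq v).trans_eq ?_)
    rw [sub_self, Real.rpow_zero]
    ring
  -- `T q D v = A T q D x` is minus the derivative of `T q D x`, which vanishes at infinity by the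
  -- assumed decay.
  have hDx : ∫ q in Ioi (0 : ℝ), T q (D v) = D x := by
    have hlim : Tendsto (fun q => T q (D x)) atTop (𝓝 0) := by
      have h2 : Tendsto (fun q : ℝ => κ * ‖x‖ * (t ^ 2 / q ^ 2)) atTop (𝓝 0) := by
        have h3 : Tendsto (fun q : ℝ => t ^ 2 / q ^ 2) atTop (𝓝 0) :=
          tendsto_const_nhds.div_atTop (tendsto_pow_atTop two_ne_zero)
        simpa using h3.const_mul (κ * ‖x‖)
      refine squeeze_zero_norm' ?_ h2
      filter_upwards [eventually_gt_atTop t] with q hq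
      have hq0 : 0 < q := ht.trans hq
      refine (hκ q hq0 x).trans_eq ?_
      rw [min_eq_right]
      · ring
      · rw [div_le_one (by positivity)]
        exact pow_le_pow_left₀ ht.le hq.le 2
    have key := integral_Ioi_of_hasDerivAt_of_tendsto (hol.continuousOn (D x) 0 self_mem_Ici)
      (f' := fun q => -T q (D v)) (fun q hq => ?_) hw.neg hlim
    · rw [integral_neg, zero_sub, neg_inj] at key
      rw [key, hT.map_zero, ContinuousLinearMap.id_apply]
    · have h2 := hasDerivAt_apply (hol.hasDerivAt_genMul hq) (D x)
      rwa [neg_apply, hT.genMul_apply_of_opGraph hol hq hDv] at h2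
  have hconv := integral_rpow_smul_integral_rpow_smul h0 h1 hw
  -- `T r D` applied to the integral for `y`; composing the fractional integrals of orders `1 - α`
  -- and `α` then recovers `D x`.
  have hinner : ∀ r ∈ Ioi (0 : ℝ), r ^ (α - 1) • ∫ s in Ioi (0 : ℝ), s ^ (-α) • T (r + s) (D v) =
      Real.Gamma (1 - α) • (r ^ (α - 1) • T r (D y)) := by
    intro r hr
    have hr0 : 0 < r := hr
    have h2 : ∀ s ∈ Ioi (0 : ℝ), s ^ (-α) • T (r + s) (D v) =
        ((T r).comp D) (s ^ (-α) • T s v) := by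
      intro s hs
      rw [ContinuousLinearMap.map_smul_of_tower, ContinuousLinearMap.comp_apply,
        hD s (le_of_lt hs), hT.apply_add hr0.le (le_of_lt hs)]
    rw [setIntegral_congr_fun measurableSet_Ioi h2, ContinuousLinearMap.integral_comp_comm _ hIv,
      ← hy, ContinuousLinearMap.map_smul_of_tower, smul_comm]
    rfl
  rw [setIntegral_congr_fun measurableSet_Ioi hinner, integral_smul, hDx, mul_comm,
    mul_smul] at hconv
  have hrep : ∫ r in Ioi (0 : ℝ), r ^ (α - 1) • T r (D y) = Real.Gamma α • D x :=
    smul_right_injective X hGα'.ne' hconv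
  obtain ⟨hi, hI⟩ := integral_rpow_mul_min h0 (by linarith) ht
  have hnorm : ‖Real.Gamma α • D x‖ ≤ κ * ‖y‖ * (t ^ α * (1 / α + 1 / (2 - α))) := by
    rw [← hrep, ← hI, ← integral_const_mul]
    refine norm_integral_le_of_norm_le (hi.const_mul _)
      ((ae_restrict_mem measurableSet_Ioi).mono fun r hr => ?_)
    rw [norm_smul, Real.norm_of_nonneg (Real.rpow_nonneg (le_of_lt hr) _)]
    calc r ^ (α - 1) * ‖T r (D y)‖
        ≤ r ^ (α - 1) * (κ * min 1 (t ^ 2 / r ^ 2) * ‖y‖) :=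
          mul_le_mul_of_nonneg_left (hκ r hr y) (Real.rpow_nonneg (le_of_lt hr) _)
      _ = _ := by ring
  have hκy : 0 ≤ κ * ‖y‖ := by
    have := (norm_nonneg _).trans (hκ t ht y)
    rwa [div_self (by positivity), min_self, mul_one] at this
  -- The left side is `2 / (α (2 - α))`, so the claim is `1 ≤ (2 - α) Γ(1 + α)`.
  have hconst : 1 / α + 1 / (2 - α) ≤ 2 * Real.Gamma α := by
    have h2 := one_le_two_sub_mul_Gamma h0 h1
    rw [add_comm 1 α, Real.Gamma_add_one h0.ne'] at h2
    have h3 : 0 < 2 - α := by linarith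
    rw [div_add_div _ _ h0.ne' h3.ne', div_le_iff₀ (by positivity)]
    nlinarith
  rw [norm_smul, Real.norm_of_nonneg hGα.le] at hnorm
  refine le_of_mul_le_mul_left (hnorm.trans ?_) hGα
  have htα : 0 ≤ t ^ α := Real.rpow_nonneg ht.le _
  calc κ * ‖y‖ * (t ^ α * (1 / α + 1 / (2 - α)))
      ≤ κ * ‖y‖ * (t ^ α * (2 * Real.Gamma α)) := by gcongr
    _ = Real.Gamma α * (2 * κ * t ^ α * ‖y‖) := by ring

namespace IsNormalizedCM

variable [CompleteSpace X] {g : ℝ → ℝ} {c : ℝ} {n : ℕ} {t : ℝ}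

/-- The basic error bound, uniform along the semigroup. -/
lemma norm_apply_error_le (hT : IsC0Semigroup T) (hol : IsSectoriallyBoundedHolomorphic T)
    (hg : IsNormalizedCM g c) (hn : 0 < n) (ht : 0 < t) {r : ℝ} (hr : 0 ≤ r) (x : X) :
    ‖T r (approximant T g n t x - T t x)‖ ≤
      (3 * supM T 0 + 3 * supM T 1 + supM T 2 / 2) * ((c - 1) / n) * ‖x‖ :=
  (hg.norm_semigroup_error_le hT hol hn ht hr
    fun _ hu => hT.norm_taylor_shift_le hol ht hr x hu).trans_eq (by ring)

/-- The error bound for smooth data. -/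
lemma norm_error_le_of_opGraph (hT : IsC0Semigroup T) (hol : IsSectoriallyBoundedHolomorphic T)
    (hg : IsNormalizedCM g c) (hn : 0 < n) (ht : 0 < t) {x y : X} (hxy : OpGraph T x y) :
    ‖approximant T g n t x - T t x‖ ≤ supM T 1 * ((c - 1) / n) * t * ‖y‖ := by
  have h := hg.norm_semigroup_error_le hT hol hn ht le_rfl
    fun _ hu => hT.norm_taylor_le_of_opGraph hol ht hxy hu
  rw [hT.map_zero, ContinuousLinearMap.id_apply] at h
  exact h.trans_eq (by ring)

/-- The error bound in operator norm. -/
lemma norm_error_le (hT : IsC0Semigroup T) (hol : IsSectoriallyBoundedHolomorphic T)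
    (hg : IsNormalizedCM g c) (hn : 0 < n) (ht : 0 < t) :
    ‖approximant T g n t - T t‖ ≤
      (3 * supM T 0 + 3 * supM T 1 + supM T 2 / 2) * ((c - 1) / n) := by
  have h0 := IsC0Semigroup.supM_nonneg (T := T)
  have hv := hg.variance_nonneg hn
  refine ContinuousLinearMap.opNorm_le_bound _
    (mul_nonneg (by linarith [h0 0, h0 1, h0 2]) hv) fun x => ?_
  have h := hg.norm_apply_error_le hT hol hn ht le_rfl x
  rwa [hT.map_zero, ContinuousLinearMap.id_apply] at h

lemma norm_apply_error_le_min (hT : IsC0Semigroup T) (hol : IsSectoriallyBoundedHolomorphic T)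
    (hg : IsNormalizedCM g c) (hn : 0 < n) (ht : 0 < t) {r : ℝ} (hr : 0 < r) (x : X) :
    ‖T r ((approximant T g n t - T t) x)‖ ≤
      (3 * supM T 0 + 3 * supM T 1 + supM T 2 / 2) * ((c - 1) / n) *
        min 1 (t ^ 2 / r ^ 2) * ‖x‖ := by
  have h0 := IsC0Semigroup.supM_nonneg (T := T)
  have hv := hg.variance_nonneg hn
  rw [sub_apply]
  rcases min_choice 1 (t ^ 2 / r ^ 2) with h | h <;> rw [h]
  · rw [mul_one]
    exact hg.norm_apply_error_le hT hol hn ht hr.le x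
  · have hb := hg.norm_semigroup_error_le hT hol hn ht hr.le
      fun _ hu => hT.norm_taylor_shift_le_div_sq hol ht hr x hu
    have hle : supM T 2 / 2 ≤ 3 * supM T 0 + 3 * supM T 1 + supM T 2 / 2 := by
      linarith [h0 0, h0 1]
    calc _ ≤ supM T 2 / 2 * (t ^ 2 / r ^ 2) * ‖x‖ * ((c - 1) / n) := hb
      _ = supM T 2 / 2 * ((c - 1) / n) * (t ^ 2 / r ^ 2) * ‖x‖ := by ring
      _ ≤ _ := by gcongr

/-- The error bound for data in the domain of a fractional power. -/
lemma norm_error_le_of_fracPowGraph (hT : IsC0Semigroup T)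
    (hol : IsSectoriallyBoundedHolomorphic T) (hg : IsNormalizedCM g c) (hn : 0 < n) (ht : 0 < t)
    {α : ℝ} (h0 : 0 < α) (h1 : α < 1) {x y : X} (hxy : FracPowGraph T α x y) :
    ‖approximant T g n t x - T t x‖ ≤
      2 * ((3 * supM T 0 + 3 * supM T 1 + supM T 2 / 2) * ((c - 1) / n)) * t ^ α * ‖y‖ := by
  have hcomm : ∀ s, 0 ≤ s → ∀ x, (approximant T g n t - T t) (T s x) =
      T s ((approximant T g n t - T t) x) := by
    intro s hs x
    rw [sub_apply, sub_apply, map_sub, hg.approximant_comm hT hol n ht hs,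
      ← hT.apply_add ht.le hs, add_comm t s, hT.apply_add hs ht.le]
  -- The bound is a closed condition on `(x, y)`, so it passes from the Balakrishnan graph to its
  -- closure.
  have hclosed : IsClosed {p : X × X | ‖(approximant T g n t - T t) p.1‖ ≤
      2 * ((3 * supM T 0 + 3 * supM T 1 + supM T 2 / 2) * ((c - 1) / n)) * t ^ α * ‖p.2‖} :=
    isClosed_le (by fun_prop) (by fun_prop)
  exact closure_minimal (fun p hp => hp.norm_apply_le hT hol hcomm ht
    (fun r hr x => hg.norm_apply_error_le_min hT hol hn ht hr x) h0 h1) hclosed hxy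

end IsNormalizedCM

end Approximation

theorem theorem1p3 {X : Type*} [NormedAddCommGroup X] [NormedSpace ℂ X] [CompleteSpace X]
    (T : ℝ → X →L[ℂ] X) (hT : IsC0Semigroup T) (hol : IsSectoriallyBoundedHolomorphic T)
    (g : ℝ → ℝ → ℝ) (c : ℝ → ℝ) (hg : ∀ t : ℝ, 0 < t → IsNormalizedCM (g t) (c t))
    (K : ℝ) (hK : K = 3 * supM T 0 + 3 * supM T 1 + supM T 2 / 2) :
    (∀ k : ℕ, k ≤ 2 →
      (∀ t : ℝ, 0 < t → ∃ B : X →L[ℂ] X, IsPowSemigroup T k t B) ∧ BddAbove (powNorms T k)) ∧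
    (∀ n : ℕ, 0 < n → ∀ t : ℝ, 0 < t → ∀ x y : X, OpGraph T x y →
      ‖approximant T (g t) n t x - T t x‖
        ≤ (2 * supM T 0 + 3 * supM T 1 / 2) * ((c t - 1) / n) * t * ‖y‖) ∧
    (∀ n : ℕ, 0 < n → ∀ t : ℝ, 0 < t →
      ‖approximant T (g t) n t - T t‖ ≤ K * ((c t - 1) / n)) ∧
    (∀ α : ℝ, 0 < α → α < 1 → ∀ n : ℕ, 0 < n → ∀ t : ℝ, 0 < t → ∀ x y : X,
      FracPowGraph T α x y →
      ‖approximant T (g t) n t x - T t x‖ ≤ 4 * K * ((c t - 1) / n) * t ^ α * ‖y‖ ∧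
      ‖approximant T (g t) n t x - T t x‖
        ≤ 3 * supM T 0 * K * ((c t - 1) / n) * t ^ α * ‖y‖) := by
  have hM := IsC0Semigroup.supM_nonneg (T := T)
  have hK0 : 0 ≤ K := by rw [hK]; linarith [hM 0, hM 1, hM 2]
  refine ⟨fun k hk => ?_, fun n hn t ht x y hxy => ?_, fun n hn t ht => ?_,
    fun α h0 h1 n hn t ht x y hxy => ?_⟩
  · interval_cases k
    · exact ⟨fun t _ => ⟨_, IsC0Semigroup.isPowSemigroup_zero t⟩,
        IsC0Semigroup.bddAbove_powNorms_zero hol⟩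
    · exact ⟨fun t ht => ⟨_, hT.isPowSemigroup_one hol ht⟩, hT.bddAbove_powNorms_one hol⟩
    · exact ⟨fun t ht => ⟨_, hT.isPowSemigroup_two hol ht⟩, hT.bddAbove_powNorms_two hol⟩
  · have hv := (hg t ht).variance_nonneg hn
    refine ((hg t ht).norm_error_le_of_opGraph hT hol hn ht hxy).trans ?_
    gcongr
    linarith [hM 0, hM 1]
  · rw [hK]
    exact (hg t ht).norm_error_le hT hol hn ht
  · have h := (hg t ht).norm_error_le_of_fracPowGraph hT hol hn ht h0 h1 hxy
    rw [← hK] at h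
    have hv := (hg t ht).variance_nonneg hn
    have hb : 0 ≤ K * ((c t - 1) / n) * t ^ α * ‖y‖ := by positivity
    refine ⟨by nlinarith, ?_⟩
    -- `M₀ ≥ 1`, hence `2 ≤ 3 M₀`, needs a nonzero vector; on the trivial space both sides vanish.
    rcases subsingleton_or_nontrivial X with hX | hX
    · rw [Subsingleton.elim (approximant T (g t) n t x - T t x) 0, norm_zero,
        Subsingleton.elim y 0, norm_zero, mul_zero]
    · have hM0 := hT.one_le_supM hol
      nlinarith
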